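/- **Wasserstein Newton's flow of the KL divergence.** Let $\Omega\subseteq\mathbb R^d$ be open, let $f\in C^\infty(\Omega)$ with $Z=\int_\Omega e^{-f}dx<\infty$, let $\rho^*=e^{-f}/Z$, and let $E(\rho)=\mathrm{KL}(\rho\|\rho^*)=\int_\Omega\rho\log\frac{\rho}{\rho^*}\,dx$. Densities are smooth positive functions $\rho$ on $\Omega$ with $\int_\Omega\rho\,dx=1$, and those at which derivatives of $E$ are taken satisfy $E(\rho)<\infty$. *Definitions.* For $\Phi\in C^\infty(\Omega)$ put $\mathcal G(\rho)^{-1}\Phi=-\nabla\cdot(\rho\nabla\Phi)$ (the inverse Wasserstein metric tensor); the metric is $g_\rho(\tau,\mathcal G(\rho)^{-1}\Psi)=\int_\Omega\tau\Psi\,dx$ for $\Psi\in C_c^\infty(\Omega)$. The gradient is $\mathrm{grad}\,E(\rho)=\mathcal G(\rho)^{-1}\frac{\delta E}{\delta\rho}$, where $\frac{\delta E}{\delta\rho}\in C^\infty(\Omega)$ is the $L^2$ first variation: $\frac{d}{d\varepsilon}E(\rho+\varepsilon\sigma)|_{\varepsilon=0}=\int_\Omega\frac{\delta E}{\delta\rho}\sigma\,dx$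 for all $\sigma\in C_c^\infty(\Omega)$ with $\int_\Omega\sigma\,dx=0$. A Wasserstein geodesic from $\rho$ with initial velocity $\mathcal G(\rho)^{-1}\Phi$, $\Phi\in C_c^\infty(\Omega)$, is a smooth pair $(\hat\rho_s,\Phi_s)$, $|s|<\varepsilon$, of densities $\hat\rho_s$ and potentials $\Phi_s$ supported in a fixed compact subset of $\Omega$, with $\partial_s\hat\rho_s+\nabla\cdot(\hat\rho_s\nabla\Phi_s)=0$, $\partial_s\Phi_s+\frac12\|\nabla\Phi_s\|^2=0$, $\hat\rho_0=\rho$, $\Phi_0=\Phi$. The Hessian operator $\mathcal H_E(\rho)=\mathrm{Hess}\,E(\rho)\circ\mathcal G(\rho)^{-1}$ is a linear operator $C^\infty(\Omega)\to C^\infty(\Omega)$ that is self-adjoint, i.e. $\int_\Omega\Psi\,\mathcal H_E(\rho)\Phi\,dx=\int_\Omega\Phi\,\mathcal H_E(\rho)\Psi\,dx$ for $\Phi\in C^\infty(\Omega)$, $\Psi\in C_c^\infty(\Omega)$ (with $\Phi\,\mathcal H_E(\rho)\Psi$ integrable on $\Omega$), and that satisfies $\int_\Omega\Phi\,\mathcal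 H_E(\rho)\Phi\,dx=\frac{d^2}{ds^2}E(\hat\rho_s)|_{s=0}$ for all $\Phi\in C_c^\infty(\Omega)$, along every geodesic from $\rho$ with initial velocity $\mathcal G(\rho)^{-1}\Phi$ (such geodesics being required to exist). For a set of times $I\subseteq\mathbb R$ (typically an interval), curves $(\rho_t)_{t\in I}$ of densities with $E(\rho_t)<\infty$ and $(\Phi_t)_{t\in I}$ in $C^\infty(\Omega)$ form a Wasserstein Newton's flow of $E$, $\partial_t\rho_t=-(\mathrm{Hess}\,E(\rho_t))^{-1}\mathrm{grad}\,E(\rho_t)$, with potential $\Phi_t$, if for all $t\in I$, on $\Omega$, $\partial_t\rho_t=\mathcal G(\rho_t)^{-1}\Phi_t$ and $\mathcal H_E(\rho_t)\Phi_t=-\mathrm{grad}\,E(\rho_t)$ (that is, $\mathrm{Hess}\,E(\rho_t)\,\partial_t\rho_t=-\mathrm{grad}\,E(\rho_t)$). *Theorem.* 1. Let $\rho$ be a density with $E(\rho)<\infty$. For every $\Phi\in C_c^\infty(\Omega)$, geodesics from $\rho$ with initial velocity $\sigma=\mathcal G(\rho)^{-1}\Phi$ exist, and along each of them $$g_\rho(\sigma,\mathrm{Hess}\,E(\rho)\sigma)=\frac{d^2}{ds^2}E(\hat\rho_s)\Big|_{s=0}=\int_\Omega\big(\|\nabla^2\Phi\|_F^2+\nabla\Phi^T\nabla^2f\,\nabla\Phi\big)\rho\,dx.$$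 The Hessian operator exists, is unique, and is $\mathcal H_E(\rho)\Phi=\nabla^2:(\rho\nabla^2\Phi)-\nabla\cdot(\rho\nabla^2f\,\nabla\Phi)$ for all $\Phi\in C^\infty(\Omega)$. 2. Let $(\rho_t)_{t\in I}$ be densities with $E(\rho_t)<\infty$ and let $\Phi_t\in C^\infty(\Omega)$. Then $(\rho_t)$ is a Wasserstein Newton's flow of $E$ with potential $(\Phi_t)$ if and only if, for all $t\in I$, on $\Omega$, $$\partial_t\rho_t+\nabla\cdot(\rho_t\nabla\Phi_t)=0,$$ $$\nabla^2:(\rho_t\nabla^2\Phi_t)-\nabla\cdot(\rho_t\nabla^2f\,\nabla\Phi_t)-\nabla\cdot(\rho_t\nabla f)-\Delta\rho_t=0.$$ -/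

import Mathlib

open MeasureTheory Set Filter Topology
open scoped ContDiff

/-- Euclidean space `ℝ^d`. -/
abbrev Rd (d : ℕ) : Type := EuclideanSpace ℝ (Fin d)

section Calculus

/-- The partial derivative `∂_i u`. -/
noncomputable def pd {d : ℕ} (i : Fin d) (u : Rd d → ℝ) (x : Rd d) : ℝ :=
  fderiv ℝ u x (EuclideanSpace.single i 1)

/-- The Hessian matrix `∇²u = (∂_i ∂_j u)_{ij}`. -/
noncomputable def hessian {d : ℕ} (u : Rd d → ℝ) (x : Rd d) : Matrix (Fin d) (Fin d) ℝ :=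
  Matrix.of fun i j => pd i (pd j u) x

/-- The divergence `∇·v = ∑_i ∂_i v_i`. -/
noncomputable def divergence {d : ℕ} (v : Rd d → Rd d) (x : Rd d) : ℝ :=
  ∑ i, pd i (fun y => v y i) x

/-- The double divergence `∇²:A = ∑_{ij} ∂_i ∂_j A_{ij}` of a matrix field. -/
noncomputable def doubleDivergence {d : ℕ} (A : Rd d → Matrix (Fin d) (Fin d) ℝ) (x : Rd d) : ℝ :=
  ∑ i, ∑ j, pd i (pd j (fun y => A y i j)) x

/-- The vector field `∇²f ∇Φ`. -/
noncomputable def hessianMulGradient {d : ℕ} (f Φ : Rd d → ℝ) (x : Rd d) : Rd d :=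
  Matrix.toEuclideanLin (hessian f x) (gradient Φ x)

/-- Smooth functions on the open set `Ω` (the values outside `Ω` play no role). -/
def SmoothOn {d : ℕ} (Ω : Set (Rd d)) (u : Rd d → ℝ) : Prop := ContDiffOn ℝ ∞ u Ω

/-- Smooth functions with compact support inside `Ω`. -/
def IsTest {d : ℕ} (Ω : Set (Rd d)) (ψ : Rd d → ℝ) : Prop :=
  ContDiff ℝ ∞ ψ ∧ HasCompactSupport ψ ∧ tsupport ψ ⊆ Ω

/-- `g` is differentiable near `s₀` and `g''(s₀) = q`. -/
def HasSecondDerivAt (g : ℝ → ℝ) (q s₀ : ℝ) : Prop :=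
  (∀ᶠ s in 𝓝 s₀, DifferentiableAt ℝ g s) ∧ HasDerivAt (deriv g) q s₀

end Calculus

section Wasserstein

/-- Smooth positive probability densities on `Ω`. -/
structure IsDensity {d : ℕ} (Ω : Set (Rd d)) (ρ : Rd d → ℝ) : Prop where
  smooth : SmoothOn Ω ρ
  pos : ∀ x ∈ Ω, 0 < ρ x
  integrable : IntegrableOn ρ Ω
  integral_eq_one : ∫ x in Ω, ρ x = 1

/-- The inverse Wasserstein metric tensor `G(ρ)⁻¹Φ = -∇·(ρ∇Φ)`, which sends a potential `Φ`
(a cotangent vector) to a tangent vector. -/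
noncomputable def metricInv {d : ℕ} (ρ Φ : Rd d → ℝ) (x : Rd d) : ℝ :=
  -divergence (fun y => ρ y • gradient Φ y) x

/-- `u` is an `L²` first variation `δE/δρ` of `E` at `ρ`: the derivative of `E` in every
direction `σ` that is smooth, compactly supported in `Ω` and of mean zero is `∫ u σ`. -/
def IsFirstVariation {d : ℕ} (Ω : Set (Rd d)) (E : (Rd d → ℝ) → ℝ) (ρ u : Rd d → ℝ) : Prop :=
  SmoothOn Ω u ∧ ∀ σ : Rd d → ℝ, IsTest Ω σ → ∫ x in Ω, σ x = 0 →
    HasDerivAt (fun ε : ℝ => E (fun x => ρ x + ε * σ x)) (∫ x in Ω, u x * σ x) 0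

/-- `τ` is the Wasserstein gradient `grad E(ρ) = G(ρ)⁻¹ (δE/δρ)`. -/
def IsWassersteinGradient {d : ℕ} (Ω : Set (Rd d)) (E : (Rd d → ℝ) → ℝ)
    (ρ τ : Rd d → ℝ) : Prop :=
  ∃ u, IsFirstVariation Ω E ρ u ∧ ∀ x ∈ Ω, τ x = metricInv ρ u x

/-- `(r_s, φ_s)`, for `s` near `0`, is a smooth Wasserstein geodesic in the space of densities,
with potentials supported in a fixed compact subset of `Ω`, that starts at `ρ` with initial
velocity `G(ρ)⁻¹Φ`: `∂_s r_s = G(r_s)⁻¹φ_s` and `∂_s φ_s + ‖∇φ_s‖²/2 = 0`. -/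
def IsWassersteinGeodesic {d : ℕ} (Ω : Set (Rd d)) (ρ Φ : Rd d → ℝ)
    (r φ : ℝ → Rd d → ℝ) : Prop :=
  ∃ ε > 0, ∃ K ⊆ Ω, IsCompact K ∧
    ContDiffOn ℝ ∞ (fun p : ℝ × Rd d => r p.1 p.2) (Ioo (-ε) ε ×ˢ Ω) ∧
    ContDiffOn ℝ ∞ (fun p : ℝ × Rd d => φ p.1 p.2) (Ioo (-ε) ε ×ˢ Ω) ∧
    (∀ x ∈ Ω, r 0 x = ρ x ∧ φ 0 x = Φ x) ∧
    ∀ s ∈ Ioo (-ε) ε,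
      IsDensity Ω (r s) ∧
      (∀ x ∈ Ω \ K, φ s x = 0) ∧
      ∀ x ∈ Ω,
        HasDerivAt (fun s' => r s' x) (metricInv (r s) (φ s) x) s ∧
        HasDerivAt (fun s' => φ s' x) (-(1 / 2 * ‖gradient (φ s) x‖ ^ 2)) s

/-- `d²/ds² E(r_s)|_{s=0} = q` along the Wasserstein geodesic that starts at `ρ` with initial
velocity `σ = G(ρ)⁻¹Φ`, that is, `g_ρ(Hess E(ρ)σ, σ) = q`. Geodesics must exist, and `q` must be
the second derivative along each of them. -/
def HasHessianForm {d : ℕ} (Ω : Set (Rd d)) (E : (Rd d → ℝ) → ℝ)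
    (ρ Φ : Rd d → ℝ) (q : ℝ) : Prop :=
  (∃ r φ, IsWassersteinGeodesic Ω ρ Φ r φ) ∧
    ∀ r φ, IsWassersteinGeodesic Ω ρ Φ r φ → HasSecondDerivAt (fun s => E (r s)) q 0

/-- `H` is the Wasserstein Hessian operator `H_E(ρ) = Hess E(ρ) ∘ G(ρ)⁻¹` from cotangent to tangent
vectors: the linear self-adjoint operator with
`∫ Φ H_E(ρ)Φ dx = g_ρ(σ, Hess E(ρ)σ) = d²/ds² E(r_s)|_{s=0}` along the geodesic with initial
velocity `σ = G(ρ)⁻¹Φ`. It acts on all smooth potentials; the quadratic form is prescribed on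
compactly supported potentials, and the duality pairing `∫ ΨHΦ dx = ∫ ΦHΨ dx` is tested with one
of the two potentials compactly supported. -/
structure IsHessianOperator {d : ℕ} (Ω : Set (Rd d)) (E : (Rd d → ℝ) → ℝ) (ρ : Rd d → ℝ)
    (H : (Rd d → ℝ) → (Rd d → ℝ)) : Prop where
  smooth : ∀ Φ, SmoothOn Ω Φ → SmoothOn Ω (H Φ)
  linear : ∀ (a b : ℝ) (Φ Ψ : Rd d → ℝ), SmoothOn Ω Φ → SmoothOn Ω Ψ →
    ∀ x ∈ Ω, H (fun y => a * Φ y + b * Ψ y) x = a * H Φ x + b * H Ψ x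
  integrable : ∀ Φ Ψ, SmoothOn Ω Φ → IsTest Ω Ψ → IntegrableOn (fun x => Φ x * H Ψ x) Ω
  selfAdjoint : ∀ Φ Ψ, SmoothOn Ω Φ → IsTest Ω Ψ →
    ∫ x in Ω, Ψ x * H Φ x = ∫ x in Ω, Φ x * H Ψ x
  form : ∀ Φ, IsTest Ω Φ → HasHessianForm Ω E ρ Φ (∫ x in Ω, Φ x * H Φ x)

/-- `ρ_t`, `t ∈ I`, is the Wasserstein Newton's flow `∂_t ρ_t = -(Hess E(ρ_t))⁻¹ grad E(ρ_t)`,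
where `Φ_t` is the potential of the velocity: `∂_t ρ_t = G(ρ_t)⁻¹Φ_t` and
`Hess E(ρ_t) ∂_t ρ_t = H_E(ρ_t)Φ_t = -grad E(ρ_t)`. -/
def IsWassersteinNewtonFlow {d : ℕ} (Ω : Set (Rd d)) (E : (Rd d → ℝ) → ℝ) (I : Set ℝ)
    (ρ Φ : ℝ → Rd d → ℝ) : Prop :=
  ∀ t ∈ I,
    (∀ x ∈ Ω, HasDerivWithinAt (fun s => ρ s x) (metricInv (ρ t) (Φ t) x) I t) ∧
    ∃ (H : (Rd d → ℝ) → (Rd d → ℝ)) (τ : Rd d → ℝ),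
      IsHessianOperator Ω E (ρ t) H ∧ IsWassersteinGradient Ω E (ρ t) τ ∧
      ∀ x ∈ Ω, H (Φ t) x = -τ x

end Wasserstein

section KullbackLeibler

/-- The target density `ρ* = exp(-f) / Z`, with `Z = ∫_Ω exp(-f) dx`. -/
noncomputable def targetDensity {d : ℕ} (Ω : Set (Rd d)) (f : Rd d → ℝ) (x : Rd d) : ℝ :=
  Real.exp (-f x) / ∫ y in Ω, Real.exp (-f y)

/-- The Kullback-Leibler divergence `KL(ρ‖ρ*) = ∫_Ω ρ log(ρ/ρ*) dx`. -/
noncomputable def KL {d : ℕ} (Ω : Set (Rd d)) (f : Rd d → ℝ) (ρ : Rd d → ℝ) : ℝ :=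
  ∫ x in Ω, ρ x * Real.log (ρ x / targetDensity Ω f x)

/-- `KL(ρ‖ρ*)` is finite. -/
def FiniteKL {d : ℕ} (Ω : Set (Rd d)) (f : Rd d → ℝ) (ρ : Rd d → ℝ) : Prop :=
  IntegrableOn (fun x => ρ x * Real.log (ρ x / targetDensity Ω f x)) Ω

/-- The operator `Φ ↦ ∇²:(ρ∇²Φ) - ∇·(ρ∇²f∇Φ)`. -/
noncomputable def klHessian {d : ℕ} (f ρ Φ : Rd d → ℝ) (x : Rd d) : ℝ :=
  doubleDivergence (fun y => ρ y • hessian Φ y) x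
    - divergence (fun y => ρ y • hessianMulGradient f Φ y) x

end KullbackLeibler

/-! ### Directional derivatives on a normed space, and on slices of space-time -/

section DirectionalDerivatives

variable {E : Type*} [NormedAddCommGroup E] [NormedSpace ℝ E]

/-! Write L = Δ - ∇f·∇ and E(r) = ∫ r (log r + f + c). Along a geodesic (r, φ) the velocity vanishes
off a fixed compact K, so r_s = ρ there. Hence time derivatives of E are integrals of functions
vanishing off K, no boundary terms occur, and E(ρ) < ∞ controls the frozen part. One integration by
parts gives E' = -∫ r Lφ (`integral_metricInv_mul_log`). Differentiating again with the continuity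
and Hamilton-Jacobi equations, and integrating by parts once more, gives ∫ ρ (½ L‖∇Φ‖² - ∇Φ·∇LΦ);
Bochner's formula (`bochner_weightedLaplacian`) turns this into the stated quadratic form.

Geodesics are built by characteristics. For |s| Lip(∇Φ) < 1 the map X_s = id + s∇Φ is a
diffeomorphism that fixes every point outside supp Φ. The potential with value Φ + (s/2)‖∇Φ‖² along
X_s has gradient ∇Φ there and solves the Hamilton-Jacobi equation. The density with value ρ / det(1
+ s∇²Φ) along X_s solves the continuity equation by Jacobi's formula and keeps mass one by change of
variables (`exists_isWassersteinGeodesic`).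

Integrating `klHessian` by parts twice against a test function yields a symmetric bilinear form
whose diagonal is the quadratic form above, so it is a Hessian operator. It is the only one:
polarization determines the pairing of two test functions, the fundamental lemma of the calculus of
variations then determines the operator on test functions, and self-adjointness carries this to all
smooth potentials.

The first variation is log ρ + f + const, unique up to locally constant functions, and ρ∇log ρ = ∇ρ,
so the gradient is -∇·(ρ∇f) - Δρ. The flow equations are then a substitution. -/

/-- The derivative of `u` in the direction `v`. -/
noncomputable def dirDeriv (v : E) (u : E → ℝ) (x : E) : ℝ := fderiv ℝ u x v

theorem ContDiffOn.dirDeriv {U : Set E} (hU : IsOpen U) {u : E → ℝ} (hu : ContDiffOn ℝ ∞ u U)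
    (v : E) : ContDiffOn ℝ ∞ (dirDeriv v u) U :=
  (hu.fderiv_of_isOpen hU (m := ∞) (by simp)).clm_apply contDiffOn_const

theorem dirDeriv_congr {U : Set E} (hU : IsOpen U) {u w : E → ℝ} (h : ∀ x ∈ U, u x = w x)
    (v : E) {x : E} (hx : x ∈ U) : dirDeriv v u x = dirDeriv v w x := by
  have : u =ᶠ[𝓝 x] w := by
    filter_upwards [hU.mem_nhds hx] with y hy using h y hy
  simp [dirDeriv, this.fderiv_eq]

theorem ContDiffOn.differentiableAt_of_isOpen {F : Type*} [NormedAddCommGroup F] [NormedSpace ℝ F]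
    {U : Set E} (hU : IsOpen U) {u : E → F}
    (hu : ContDiffOn ℝ ∞ u U) {x : E} (hx : x ∈ U) : DifferentiableAt ℝ u x :=
  (hu.contDiffAt (hU.mem_nhds hx)).differentiableAt (by simp)

/-- Stated on a general normed space so that it also exchanges time and space derivatives on ℝ × Rd.
-/
theorem dirDeriv_comm {U : Set E} (hU : IsOpen U) {u : E → ℝ} (hu : ContDiffOn ℝ ∞ u U)
    (v w : E) {x : E} (hx : x ∈ U) :
    dirDeriv v (dirDeriv w u) x = dirDeriv w (dirDeriv v u) x := by
  have hd : DifferentiableAt ℝ (fderiv ℝ u) x :=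
    (hu.fderiv_of_isOpen hU (m := ∞) (by simp)).differentiableAt_of_isOpen hU hx
  have key : ∀ a b : E, dirDeriv a (dirDeriv b u) x = fderiv ℝ (fderiv ℝ u) x a b := by
    intro a b
    unfold dirDeriv
    rw [fderiv_clm_apply hd (differentiableAt_const b)]
    simp
  rw [key, key]
  exact ((hu.contDiffAt (hU.mem_nhds hx)).isSymmSndFDerivAt
    (by simp only [minSmoothness_of_isRCLikeNormedField]; exact WithTop.coe_le_coe.2 le_top)).eq v w

section Rules

variable {u w : E → ℝ} {x : E} (v : E)

theorem dirDeriv_const (c : ℝ) : dirDeriv v (fun _ => c) x = 0 := by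
  simp [dirDeriv]

theorem dirDeriv_add (hu : DifferentiableAt ℝ u x) (hw : DifferentiableAt ℝ w x) :
    dirDeriv v (fun y => u y + w y) x = dirDeriv v u x + dirDeriv v w x := by
  simp [dirDeriv, fderiv_fun_add hu hw]

theorem dirDeriv_sub (hu : DifferentiableAt ℝ u x) (hw : DifferentiableAt ℝ w x) :
    dirDeriv v (fun y => u y - w y) x = dirDeriv v u x - dirDeriv v w x := by
  simp [dirDeriv, fderiv_fun_sub hu hw]

theorem dirDeriv_neg : dirDeriv v (fun y => -u y) x = -dirDeriv v u x := by
  simp [dirDeriv]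

theorem dirDeriv_mul (hu : DifferentiableAt ℝ u x) (hw : DifferentiableAt ℝ w x) :
    dirDeriv v (fun y => u y * w y) x = dirDeriv v u x * w x + u x * dirDeriv v w x := by
  simp [dirDeriv, fderiv_fun_mul hu hw]; ring

theorem dirDeriv_const_mul (c : ℝ) (hu : DifferentiableAt ℝ u x) :
    dirDeriv v (fun y => c * u y) x = c * dirDeriv v u x := by
  rw [dirDeriv_mul v (differentiableAt_const c) hu, dirDeriv_const]; ring

theorem dirDeriv_sq (hu : DifferentiableAt ℝ u x) :
    dirDeriv v (fun y => u y ^ 2) x = 2 * u x * dirDeriv v u x := by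
  simp only [pow_two]
  rw [dirDeriv_mul v hu hu]; ring

theorem dirDeriv_sum {ι : Type*} (s : Finset ι) {g : ι → E → ℝ}
    (h : ∀ i ∈ s, DifferentiableAt ℝ (g i) x) :
    dirDeriv v (fun y => ∑ i ∈ s, g i y) x = ∑ i ∈ s, dirDeriv v (g i) x := by
  simp [dirDeriv, fderiv_fun_sum h]

theorem dirDeriv_log (hu : DifferentiableAt ℝ u x) (hx : u x ≠ 0) :
    dirDeriv v (fun y => Real.log (u y)) x = (u x)⁻¹ * dirDeriv v u x := by
  simp [dirDeriv, (hu.hasFDerivAt.log hx).fderiv]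

end Rules

section Slices

variable {h : ℝ × E → ℝ} {s : ℝ} {x : E}

theorem dirDeriv_slice (hh : DifferentiableAt ℝ h (s, x)) (v : E) :
    dirDeriv v (fun y => h (s, y)) x = dirDeriv ((0 : ℝ), v) h (s, x) := by
  have h1 : HasFDerivAt (fun y : E => (s, y)) (ContinuousLinearMap.inr ℝ ℝ E) x :=
    hasFDerivAt_prodMk_right s x
  have h2 : HasFDerivAt (fun y => h (s, y)) _ x := HasFDerivAt.comp x hh.hasFDerivAt h1
  simp [dirDeriv, h2.fderiv]

theorem hasDerivAt_slice (hh : DifferentiableAt ℝ h (s, x)) :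
    HasDerivAt (fun t => h (t, x)) (dirDeriv ((1 : ℝ), (0 : E)) h (s, x)) s := by
  have h1 : HasFDerivAt (fun t : ℝ => (t, x)) (ContinuousLinearMap.inl ℝ ℝ E) s :=
    hasFDerivAt_prodMk_left s x
  have h2 : HasFDerivAt (fun t => h (t, x)) _ s := HasFDerivAt.comp s hh.hasFDerivAt h1
  simpa [dirDeriv] using h2.hasDerivAt

theorem ContDiffOn.slice {J : Set ℝ} {Ω : Set E} (hh : ContDiffOn ℝ ∞ h (J ×ˢ Ω)) (hs : s ∈ J) :
    ContDiffOn ℝ ∞ (fun y => h (s, y)) Ω :=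
  hh.comp (contDiffOn_const.prodMk contDiffOn_id) fun _ hy => ⟨hs, hy⟩

end Slices

end DirectionalDerivatives

/-! ### Coordinate formulas for the differential operators -/

section PartialDerivatives

variable {d : ℕ}

theorem pd_eq_dirDeriv (i : Fin d) : pd i = dirDeriv (EuclideanSpace.single i (1 : ℝ)) := rfl

theorem SmoothOn.pd {Ω : Set (Rd d)} (hΩ : IsOpen Ω) {u : Rd d → ℝ} (hu : SmoothOn Ω u)
    (i : Fin d) : SmoothOn Ω (pd i u) :=
  ContDiffOn.dirDeriv hΩ hu _

namespace SmoothOn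

variable {Ω : Set (Rd d)} {u w : Rd d → ℝ}

theorem diff (hΩ : IsOpen Ω) (hu : SmoothOn Ω u) {x : Rd d} (hx : x ∈ Ω) :
    DifferentiableAt ℝ u x := ContDiffOn.differentiableAt_of_isOpen hΩ hu hx

theorem mul (hu : SmoothOn Ω u) (hw : SmoothOn Ω w) : SmoothOn Ω fun x => u x * w x :=
  ContDiffOn.mul hu hw

theorem add (hu : SmoothOn Ω u) (hw : SmoothOn Ω w) : SmoothOn Ω fun x => u x + w x :=
  ContDiffOn.add hu hw

theorem sub (hu : SmoothOn Ω u) (hw : SmoothOn Ω w) : SmoothOn Ω fun x => u x - w x :=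
  ContDiffOn.sub hu hw

theorem neg (hu : SmoothOn Ω u) : SmoothOn Ω fun x => -u x := ContDiffOn.neg hu

theorem sq (hu : SmoothOn Ω u) : SmoothOn Ω fun x => u x ^ 2 := ContDiffOn.pow hu 2

theorem const (c : ℝ) : SmoothOn Ω fun _ => c := contDiffOn_const

theorem sum {ι : Type*} {s : Finset ι} {g : ι → Rd d → ℝ} (h : ∀ i ∈ s, SmoothOn Ω (g i)) :
    SmoothOn Ω fun x => ∑ i ∈ s, g i x := ContDiffOn.sum h

theorem log (hu : SmoothOn Ω u) (hpos : ∀ x ∈ Ω, 0 < u x) :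
    SmoothOn Ω fun x => Real.log (u x) := ContDiffOn.log hu fun x hx => (hpos x hx).ne'

end SmoothOn

theorem gradient_apply (u : Rd d → ℝ) (x : Rd d) (i : Fin d) : gradient u x i = pd i u x := by
  have h : inner ℝ (gradient u x) (EuclideanSpace.single i (1 : ℝ)) = pd i u x := by
    rw [gradient, InnerProductSpace.toDual_symm_apply, pd]
  rw [← h, EuclideanSpace.inner_single_right]
  simp

theorem fderiv_eq_sum_pd (u : Rd d → ℝ) (x v : Rd d) : fderiv ℝ u x v = ∑ i, v i * pd i u x := by
  have : v = ∑ i, v i • EuclideanSpace.single i (1 : ℝ) := by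
    ext j; simp [Finset.sum_apply, Pi.single_apply]
  conv_lhs => rw [this]
  simp [pd]

theorem hessianMulGradient_apply (f Φ : Rd d → ℝ) (x : Rd d) (i : Fin d) :
    hessianMulGradient f Φ x i = ∑ j, pd i (pd j f) x * pd j Φ x := by
  simp [hessianMulGradient, Matrix.toLpLin_apply, Matrix.mulVec, dotProduct, hessian,
    gradient_apply]

theorem divergence_smul_gradient (ρ Φ : Rd d → ℝ) (x : Rd d) :
    divergence (fun y => ρ y • gradient Φ y) x = ∑ i, pd i (fun y => ρ y * pd i Φ y) x := by
  simp [divergence, gradient_apply]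

theorem divergence_smul_hessianMulGradient (f ρ Φ : Rd d → ℝ) (x : Rd d) :
    divergence (fun y => ρ y • hessianMulGradient f Φ y) x
      = ∑ i, pd i (fun y => ρ y * ∑ j, pd i (pd j f) y * pd j Φ y) x := by
  simp [divergence, hessianMulGradient_apply]

theorem doubleDivergence_smul_hessian (ρ Φ : Rd d → ℝ) (x : Rd d) :
    doubleDivergence (fun y => ρ y • hessian Φ y) x
      = ∑ i, ∑ j, pd i (pd j (fun y => ρ y * pd i (pd j Φ) y)) x := by
  simp [doubleDivergence, hessian]

theorem metricInv_eq (ρ Φ : Rd d → ℝ) (x : Rd d) :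
    metricInv ρ Φ x = -∑ i, pd i (fun y => ρ y * pd i Φ y) x := by
  rw [metricInv, divergence_smul_gradient]

theorem norm_gradient_sq (Φ : Rd d → ℝ) (x : Rd d) :
    ‖gradient Φ x‖ ^ 2 = ∑ i, pd i Φ x ^ 2 := by
  simp [EuclideanSpace.norm_sq_eq, gradient_apply]

theorem laplacian_eq_sum_pd {Ω : Set (Rd d)} (hΩ : IsOpen Ω) {u : Rd d → ℝ} (hu : SmoothOn Ω u)
    {x : Rd d} (hx : x ∈ Ω) : Laplacian.laplacian u x = ∑ i, pd i (pd i u) x := by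
  rw [InnerProductSpace.laplacian_eq_iteratedFDeriv_orthonormalBasis u
    (EuclideanSpace.basisFun (Fin d) ℝ)]
  refine Finset.sum_congr rfl fun i _ => ?_
  have hd : DifferentiableAt ℝ (fderiv ℝ u) x :=
    (hu.fderiv_of_isOpen hΩ (m := ∞) (by simp)).differentiableAt_of_isOpen hΩ hx
  rw [iteratedFDeriv_two_apply]
  unfold pd
  rw [fderiv_clm_apply hd (differentiableAt_const _)]
  simp

end PartialDerivatives

/-! ### Integration by parts and differentiation under the integral, relative to a compact subset -/

section VanishingOutsideCompact

variable {d : ℕ} {Ω K : Set (Rd d)}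

/-- `u` vanishes at the points of `Ω` outside `K`. -/
def VanishesOff (Ω K : Set (Rd d)) (u : Rd d → ℝ) : Prop := ∀ x ∈ Ω \ K, u x = 0

theorem VanishesOff.mul_left {u : Rd d → ℝ} (hu : VanishesOff Ω K u) (w : Rd d → ℝ) :
    VanishesOff Ω K fun x => w x * u x := fun x hx => by simp [hu x hx]

theorem VanishesOff.mul_right {u : Rd d → ℝ} (hu : VanishesOff Ω K u) (w : Rd d → ℝ) :
    VanishesOff Ω K fun x => u x * w x := fun x hx => by simp [hu x hx]

theorem VanishesOff.add {u w : Rd d → ℝ} (hu : VanishesOff Ω K u) (hw : VanishesOff Ω K w) :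
    VanishesOff Ω K fun x => u x + w x := fun x hx => by simp [hu x hx, hw x hx]

theorem VanishesOff.sub {u w : Rd d → ℝ} (hu : VanishesOff Ω K u) (hw : VanishesOff Ω K w) :
    VanishesOff Ω K fun x => u x - w x := fun x hx => by simp [hu x hx, hw x hx]

theorem VanishesOff.neg {u : Rd d → ℝ} (hu : VanishesOff Ω K u) :
    VanishesOff Ω K fun x => -u x := fun x hx => by simp [hu x hx]

theorem VanishesOff.sum {ι : Type*} {s : Finset ι} {u : ι → Rd d → ℝ}
    (hu : ∀ i ∈ s, VanishesOff Ω K (u i)) : VanishesOff Ω K fun x => ∑ i ∈ s, u i x :=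
  fun x hx => Finset.sum_eq_zero fun i hi => hu i hi x hx

/-- Ω \ K is open, so differentiation does not enlarge K; one K serves derivatives of every order.
-/
theorem VanishesOff.pd (hΩ : IsOpen Ω) (hK : IsCompact K) {u : Rd d → ℝ}
    (hu : VanishesOff Ω K u) (i : Fin d) : VanishesOff Ω K (pd i u) := fun x hx => by
  have := dirDeriv_congr (hΩ.sdiff hK.isClosed) (w := fun _ => 0) hu
    (EuclideanSpace.single i (1 : ℝ)) hx
  rw [dirDeriv_const] at this
  exact this

theorem VanishesOff.integrableOn (hΩ : IsOpen Ω) (hK : IsCompact K) (hKΩ : K ⊆ Ω) {u : Rd d → ℝ}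
    (hu : VanishesOff Ω K u) (hc : ContinuousOn u Ω) : IntegrableOn u Ω :=
  ((hc.mono hKΩ).integrableOn_compact hK).of_forall_sdiff_eq_zero hΩ.measurableSet hu

/-- The extension by zero is smooth on the whole space because Ω and the complement of K form an
open cover. It is then integrated by parts against the constant 1, so the boundary of Ω never
matters. -/
theorem VanishesOff.integral_pd_eq_zero (hΩ : IsOpen Ω) (hK : IsCompact K) (hKΩ : K ⊆ Ω)
    {u : Rd d → ℝ} (hu : VanishesOff Ω K u) (hs : SmoothOn Ω u) (i : Fin d) :
    ∫ x in Ω, _root_.pd i u x = 0 := by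
  have hz : ∀ x ∈ Kᶜ, Ω.indicator u x = 0 := fun x hx => by
    by_cases hxΩ : x ∈ Ω
    · rw [indicator_of_mem hxΩ, hu x ⟨hxΩ, hx⟩]
    · rw [indicator_of_notMem hxΩ]
  have hsm : ContDiff ℝ ∞ (Ω.indicator u) := by
    rw [contDiff_iff_contDiffAt]
    intro x
    by_cases hxΩ : x ∈ Ω
    · refine (hs.contDiffAt (hΩ.mem_nhds hxΩ)).congr_of_eventuallyEq ?_
      filter_upwards [hΩ.mem_nhds hxΩ] with y hy using indicator_of_mem hy u
    · refine (contDiffAt_const (c := (0 : ℝ))).congr_of_eventuallyEq ?_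
      filter_upwards [hK.isClosed.isOpen_compl.mem_nhds fun h => hxΩ (hKΩ h)] with y hy
        using hz y hy
  have hcs : HasCompactSupport (Ω.indicator u) := HasCompactSupport.intro hK fun x hx => hz x hx
  have hpd : Ω.indicator (_root_.pd i u) = fun x =>
      1 * fderiv ℝ (Ω.indicator u) x (EuclideanSpace.single i 1) := by
    funext x
    rw [one_mul]
    by_cases hxΩ : x ∈ Ω
    · rw [indicator_of_mem hxΩ]
      exact dirDeriv_congr hΩ (fun y hy => (indicator_of_mem hy u).symm) _ hxΩ
    · rw [indicator_of_notMem hxΩ]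
      have := dirDeriv_congr hK.isClosed.isOpen_compl (w := fun _ => 0) hz
        (EuclideanSpace.single i (1 : ℝ)) (x := x) fun h => hxΩ (hKΩ h)
      rw [dirDeriv_const] at this
      exact this.symm
  have hint : Integrable (fun x => (1 : ℝ) *
      fderiv ℝ (Ω.indicator u) x (EuclideanSpace.single i 1)) := by
    simp only [one_mul]
    refine Continuous.integrable_of_hasCompactSupport ?_ ?_
    · exact (hsm.continuous_fderiv (by simp)).clm_apply continuous_const
    · exact (hcs.fderiv ℝ).comp_left
        (g := fun L : Rd d →L[ℝ] ℝ => L (EuclideanSpace.single i 1)) (by simp)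
  have := integral_mul_fderiv_eq_neg_fderiv_mul_of_integrable (μ := (volume : Measure (Rd d)))
    (f := fun _ => (1 : ℝ)) (g := Ω.indicator u) (v := EuclideanSpace.single i 1)
    (by simp) hint
    (by simpa using hsm.continuous.integrable_of_hasCompactSupport hcs)
    (fun _ _ => differentiableAt_const _)
    (fun x _ => hsm.differentiable (by simp) x)
  rw [← integral_indicator hΩ.measurableSet, hpd, this]
  simp

/-- Two integrands that differ by the divergence of a field vanishing outside a compact set have
the same integral. -/
theorem setIntegral_eq_of_eq_add_divergence (hΩ : IsOpen Ω) (hK : IsCompact K) (hKΩ : K ⊆ Ω)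
    {A B : Rd d → ℝ} {v : Fin d → Rd d → ℝ} (hBc : ContinuousOn B Ω) (hB : VanishesOff Ω K B)
    (hvs : ∀ i, SmoothOn Ω (v i)) (hv : ∀ i, VanishesOff Ω K (v i))
    (h : ∀ x ∈ Ω, A x = B x + ∑ i, pd i (v i) x) : ∫ x in Ω, A x = ∫ x in Ω, B x := by
  have hi : ∀ i, IntegrableOn (pd i (v i)) Ω := fun i =>
    ((hv i).pd hΩ hK i).integrableOn hΩ hK hKΩ ((hvs i).pd hΩ i).continuousOn
  rw [setIntegral_congr_fun hΩ.measurableSet h,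
    integral_add (hB.integrableOn hΩ hK hKΩ hBc) (integrable_finsetSum _ fun i _ => hi i),
    integral_finsetSum _ fun i _ => hi i]
  simp [fun i => (hv i).integral_pd_eq_zero hΩ hK hKΩ (hvs i) i]

/-- Only the time derivative has to vanish off K: on a closed time interval times K it is bounded,
and that bound times the indicator of K is the dominating function. -/
theorem hasDerivAt_setIntegral (hΩ : IsOpen Ω) (hK : IsCompact K) (hKΩ : K ⊆ Ω)
    {J : Set ℝ} (hJ : IsOpen J) {h : ℝ × Rd d → ℝ} (hh : ContDiffOn ℝ ∞ h (J ×ˢ Ω))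
    (hv : ∀ s ∈ J, VanishesOff Ω K fun x => dirDeriv ((1 : ℝ), (0 : Rd d)) h (s, x))
    {s : ℝ} (hs : s ∈ J) (hi : IntegrableOn (fun x => h (s, x)) Ω) :
    HasDerivAt (fun t => ∫ x in Ω, h (t, x))
      (∫ x in Ω, dirDeriv ((1 : ℝ), (0 : Rd d)) h (s, x)) s := by
  have hU : IsOpen (J ×ˢ Ω) := hJ.prod hΩ
  have hd : ContDiffOn ℝ ∞ (dirDeriv ((1 : ℝ), (0 : Rd d)) h) (J ×ˢ Ω) := hh.dirDeriv hU _
  obtain ⟨δ, hδ, hball⟩ := Metric.nhds_basis_closedBall.mem_iff.1 (hJ.mem_nhds hs)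
  obtain ⟨C, hC⟩ := ((isCompact_closedBall s δ).prod hK).exists_bound_of_continuousOn
    (hd.continuousOn.mono (prod_mono hball hKΩ))
  refine (hasDerivAt_integral_of_dominated_loc_of_deriv_le (bound := K.indicator fun _ => C)
    (F := fun t x => h (t, x)) (F' := fun t x => dirDeriv ((1 : ℝ), (0 : Rd d)) h (t, x))
    (Metric.closedBall_mem_nhds s hδ) ?_ hi ?_ ?_ ?_ ?_).2
  · filter_upwards [hJ.mem_nhds hs] with t ht
    exact (hh.slice ht).continuousOn.aestronglyMeasurable hΩ.measurableSet
  · exact (hd.slice hs).continuousOn.aestronglyMeasurable hΩ.measurableSet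
  · refine (ae_restrict_mem hΩ.measurableSet).mono fun x hx t ht => ?_
    by_cases hxK : x ∈ K
    · rw [indicator_of_mem hxK]
      exact hC (t, x) ⟨ht, hxK⟩
    · have := hv t (hball ht) x ⟨hx, hxK⟩
      simp only at this
      rw [indicator_of_notMem hxK, this, norm_zero]
  · rw [integrable_indicator_iff hK.measurableSet]
    exact integrableOn_const ((Measure.restrict_apply_le _ _).trans_lt hK.measure_lt_top).ne
  · exact (ae_restrict_mem hΩ.measurableSet).mono fun x hx t ht =>
      hasDerivAt_slice (hh.differentiableAt_of_isOpen hU ⟨hball ht, hx⟩)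

end VanishingOutsideCompact

/-! ### Test functions and the fundamental lemma of the calculus of variations -/

section TestFunctions

variable {d : ℕ} {Ω : Set (Rd d)}

theorem IsTest.smoothOn {ψ : Rd d → ℝ} (h : IsTest Ω ψ) : SmoothOn Ω ψ := h.1.contDiffOn

theorem IsTest.vanishesOff {ψ : Rd d → ℝ} (_h : IsTest Ω ψ) : VanishesOff Ω (tsupport ψ) ψ :=
  fun _ hx => image_eq_zero_of_notMem_tsupport hx.2

theorem IsTest.pd {ψ : Rd d → ℝ} (h : IsTest Ω ψ) (i : Fin d) : IsTest Ω (pd i ψ) := by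
  refine ⟨?_, h.2.1.fderiv_apply ℝ _, (tsupport_fderiv_apply_subset ℝ _).trans h.2.2⟩
  exact contDiffOn_univ.1 (ContDiffOn.dirDeriv isOpen_univ h.1.contDiffOn _)

theorem IsTest.linearCombination {ψ χ : Rd d → ℝ} (hψ : IsTest Ω ψ) (hχ : IsTest Ω χ) (a b : ℝ) :
    IsTest Ω fun x => a * ψ x + b * χ x := by
  have hsub : tsupport (fun x => a * ψ x + b * χ x) ⊆ tsupport ψ ∪ tsupport χ :=
    (tsupport_add _ _).trans (union_subset_union (tsupport_mul_subset_right (f := fun _ => a))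
      (tsupport_mul_subset_right (f := fun _ => b)))
  exact ⟨(contDiff_const.mul hψ.1).add (contDiff_const.mul hχ.1),
    hψ.2.1.mul_left.add hχ.2.1.mul_left, hsub.trans (union_subset hψ.2.2 hχ.2.2)⟩

theorem eq_zero_of_forall_integral_test_mul_eq_zero (hΩ : IsOpen Ω) {u : Rd d → ℝ}
    (hu : ContinuousOn u Ω) (h : ∀ ψ, IsTest Ω ψ → ∫ x in Ω, ψ x * u x = 0) :
    ∀ x ∈ Ω, u x = 0 := by
  have hae : ∀ᵐ x, x ∈ Ω → u x = 0 := by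
    refine hΩ.ae_eq_zero_of_integral_contDiff_smul_eq_zero
      (hu.locallyIntegrableOn hΩ.measurableSet) fun g hg hgc hgs => ?_
    rw [← h g ⟨hg, hgc, hgs⟩]
    refine (setIntegral_eq_integral_of_forall_compl_eq_zero fun x hx => ?_).symm
    rw [image_eq_zero_of_notMem_tsupport fun hx' => hx (hgs hx'), zero_smul]
  refine Measure.eqOn_open_of_ae_eq (μ := volume) (g := fun _ => 0) ?_ hΩ hu continuousOn_const
  exact (ae_restrict_iff' hΩ.measurableSet).2 hae

end TestFunctions

/-! ### The weighted Laplacian, Bochner's formula and the entropy integrals -/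

section WeightedLaplacian

variable {d : ℕ} {Ω K : Set (Rd d)}

/-- The generator `Δφ - ∇f·∇φ` of the Langevin diffusion with potential `f`. -/
noncomputable def weightedLaplacian (f φ : Rd d → ℝ) (x : Rd d) : ℝ :=
  ∑ i, (pd i (pd i φ) x - pd i f x * pd i φ x)

theorem SmoothOn.weightedLaplacian (hΩ : IsOpen Ω) {f φ : Rd d → ℝ} (hf : SmoothOn Ω f)
    (hφ : SmoothOn Ω φ) : SmoothOn Ω (weightedLaplacian f φ) :=
  SmoothOn.sum fun i _ => ((hφ.pd hΩ i).pd hΩ i).sub ((hf.pd hΩ i).mul (hφ.pd hΩ i))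

theorem VanishesOff.weightedLaplacian (hΩ : IsOpen Ω) (hK : IsCompact K) (f : Rd d → ℝ)
    {φ : Rd d → ℝ} (hφ : VanishesOff Ω K φ) : VanishesOff Ω K (weightedLaplacian f φ) :=
  VanishesOff.sum fun i _ => ((hφ.pd hΩ hK i).pd hΩ hK i).sub ((hφ.pd hΩ hK i).mul_left _)

theorem pd_congr (hΩ : IsOpen Ω) {u w : Rd d → ℝ} (h : ∀ x ∈ Ω, u x = w x) (i : Fin d) :
    ∀ x ∈ Ω, pd i u x = pd i w x := fun _ hx => dirDeriv_congr hΩ h _ hx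

theorem weightedLaplacian_congr (hΩ : IsOpen Ω) (f : Rd d → ℝ) {u w : Rd d → ℝ}
    (h : ∀ x ∈ Ω, u x = w x) : ∀ x ∈ Ω, weightedLaplacian f u x = weightedLaplacian f w x := by
  intro x hx
  simp only [weightedLaplacian]
  refine Finset.sum_congr rfl fun i _ => ?_
  rw [pd_congr hΩ (pd_congr hΩ h i) i x hx, pd_congr hΩ h i x hx]

theorem pd_comm (hΩ : IsOpen Ω) {u : Rd d → ℝ} (hu : SmoothOn Ω u) (i j : Fin d) {x : Rd d}
    (hx : x ∈ Ω) : pd i (pd j u) x = pd j (pd i u) x := dirDeriv_comm hΩ hu _ _ hx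

/-- The Bochner formula for the weighted Laplacian. -/
theorem bochner_weightedLaplacian (hΩ : IsOpen Ω) {f Φ : Rd d → ℝ} (hf : SmoothOn Ω f)
    (hΦ : SmoothOn Ω Φ) {x : Rd d} (hx : x ∈ Ω) :
    -weightedLaplacian f (fun y => -(1 / 2 * ∑ j, pd j Φ y ^ 2)) x
        - ∑ i, pd i Φ x * pd i (weightedLaplacian f Φ) x
      = ∑ i, ∑ j, pd i (pd j Φ) x ^ 2 + ∑ i, ∑ j, pd i Φ x * (pd i (pd j f) x * pd j Φ x) := by
  have h1 : ∀ i, SmoothOn Ω (pd i Φ) := fun i => hΦ.pd hΩ i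
  have h2 : ∀ i j, SmoothOn Ω (pd i (pd j Φ)) := fun i j => (h1 j).pd hΩ i
  have g1 : ∀ i, SmoothOn Ω (pd i f) := fun i => hf.pd hΩ i
  have e1 : ∀ i, ∀ y ∈ Ω, pd i (fun y => -(1 / 2 * ∑ j, pd j Φ y ^ 2)) y
      = ∑ j, -(pd j Φ y * pd i (pd j Φ) y) := by
    intro i y hy
    have hs : SmoothOn Ω fun y => ∑ j, pd j Φ y ^ 2 := SmoothOn.sum fun j _ => (h1 j).sq
    rw [pd_eq_dirDeriv, dirDeriv_neg, dirDeriv_const_mul _ _ (hs.diff hΩ hy),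
      dirDeriv_sum _ _ fun j _ => (h1 j).sq.diff hΩ hy, Finset.mul_sum, ← Finset.sum_neg_distrib]
    refine Finset.sum_congr rfl fun j _ => ?_
    rw [dirDeriv_sq _ ((h1 j).diff hΩ hy), pd_eq_dirDeriv]
    ring
  have e2 : ∀ i, pd i (pd i (fun y => -(1 / 2 * ∑ j, pd j Φ y ^ 2))) x
      = ∑ j, -(pd i (pd j Φ) x ^ 2 + pd j Φ x * pd i (pd i (pd j Φ)) x) := by
    intro i
    rw [pd_congr hΩ (e1 i) i x hx]
    change dirDeriv _ _ _ = _
    rw [dirDeriv_sum _ _ fun j _ => ((h1 j).mul (h2 i j)).neg.diff hΩ hx]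
    refine Finset.sum_congr rfl fun j _ => ?_
    rw [dirDeriv_neg, dirDeriv_mul _ ((h1 j).diff hΩ hx) ((h2 i j).diff hΩ hx), ← pd_eq_dirDeriv]
    ring
  have e3 : ∀ i, pd i (weightedLaplacian f Φ) x = ∑ j, (pd j (pd j (pd i Φ)) x
      - (pd i (pd j f) x * pd j Φ x + pd j f x * pd i (pd j Φ) x)) := by
    intro i
    change dirDeriv _ (fun y => ∑ j, (pd j (pd j Φ) y - pd j f y * pd j Φ y)) x = _
    rw [dirDeriv_sum _ _ fun j _ => ((h2 j j).sub ((g1 j).mul (h1 j))).diff hΩ hx]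
    refine Finset.sum_congr rfl fun j _ => ?_
    rw [dirDeriv_sub _ ((h2 j j).diff hΩ hx) (((g1 j).mul (h1 j)).diff hΩ hx),
      dirDeriv_mul _ ((g1 j).diff hΩ hx) ((h1 j).diff hΩ hx), ← pd_eq_dirDeriv,
      pd_comm hΩ (h1 j) i j hx, pd_congr hΩ (fun y hy => pd_comm hΩ hΦ i j hy) j x hx]
  -- The third derivatives of Φ cancel by relabelling, and so do the terms in ∇f (next identity),
  -- where the symmetry of ∇²Φ is also used.
  have e4 : ∑ i, ∑ j, pd j Φ x * pd i (pd i (pd j Φ)) x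
      = ∑ i, ∑ j, pd i Φ x * pd j (pd j (pd i Φ)) x := Finset.sum_comm
  have e5 : ∑ i, ∑ j, pd i f x * (pd j Φ x * pd i (pd j Φ) x)
      = ∑ i, ∑ j, pd i Φ x * (pd j f x * pd i (pd j Φ) x) := by
    rw [Finset.sum_comm]
    refine Finset.sum_congr rfl fun i _ => Finset.sum_congr rfl fun j _ => ?_
    rw [pd_comm hΩ hΦ i j hx]; ring
  simp only [weightedLaplacian, e2, e3, e1 _ x hx]
  simp only [Finset.mul_sum, mul_sub, mul_add, Finset.sum_sub_distrib, Finset.sum_add_distrib,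
    Finset.sum_neg_distrib, neg_add, mul_neg]
  rw [e4, e5]
  ring

theorem inner_gradient_hessianMulGradient (f Φ : Rd d → ℝ) (x : Rd d) :
    inner ℝ (gradient Φ x) (hessianMulGradient f Φ x)
      = ∑ i, ∑ j, pd i Φ x * (pd i (pd j f) x * pd j Φ x) := by
  rw [PiLp.inner_apply]
  refine Finset.sum_congr rfl fun i _ => ?_
  rw [gradient_apply, hessianMulGradient_apply, ← Finset.mul_sum]
  simp [mul_comm]

/-- Integration by parts for the first derivative of the relative entropy along a transport of
density `r` with potential `φ`. -/
theorem integral_metricInv_mul_log (hΩ : IsOpen Ω) (hK : IsCompact K) (hKΩ : K ⊆ Ω)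
    {f r φ : Rd d → ℝ} (hf : SmoothOn Ω f) (hr : SmoothOn Ω r) (hpos : ∀ x ∈ Ω, 0 < r x)
    (hφ : SmoothOn Ω φ) (hφK : VanishesOff Ω K φ) (c : ℝ) :
    ∫ x in Ω, metricInv r φ x * (Real.log (r x) + f x + c + 1)
      = ∫ x in Ω, r x * -weightedLaplacian f φ x := by
  have hl : SmoothOn Ω fun x => Real.log (r x) + f x + c :=
    ((hr.log hpos).add hf).add (SmoothOn.const c)
  have hv : ∀ i, SmoothOn Ω fun x => r x * pd i φ x := fun i => hr.mul (hφ.pd hΩ i)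
  refine setIntegral_eq_of_eq_add_divergence hΩ hK hKΩ
    -- The summand 1 is left out of the flux: its contribution -∇·(r∇φ) cancels the term ∇r·∇φ
    -- coming from r∇log r and leaves -rΔφ.
    (v := fun i x => -((r x * pd i φ x) * (Real.log (r x) + f x + c)))
    (hr.mul (hf.weightedLaplacian hΩ hφ).neg).continuousOn
    ((hφK.weightedLaplacian hΩ hK f).neg.mul_left r)
    (fun i => ((hv i).mul hl).neg)
    (fun i => (((hφK.pd hΩ hK i).mul_left r).mul_right _).neg) fun x hx => ?_
  have e1 : ∀ i, pd i (fun x => r x * pd i φ x) x = pd i r x * pd i φ x + r x * pd i (pd i φ) x :=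
    fun i => dirDeriv_mul _ (hr.diff hΩ hx) ((hφ.pd hΩ i).diff hΩ hx)
  have e2 : ∀ i, pd i (fun x => -((r x * pd i φ x) * (Real.log (r x) + f x + c))) x
      = -(pd i (fun x => r x * pd i φ x) x * (Real.log (r x) + f x + c)
        + r x * pd i φ x * ((r x)⁻¹ * pd i r x + pd i f x)) := by
    intro i
    change dirDeriv _ _ _ = _
    rw [dirDeriv_neg, dirDeriv_mul _ ((hv i).diff hΩ hx) (hl.diff hΩ hx),
      dirDeriv_add _ (((hr.log hpos).add hf).diff hΩ hx) (differentiableAt_const c),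
      dirDeriv_add _ ((hr.log hpos).diff hΩ hx) (hf.diff hΩ hx),
      dirDeriv_log _ (hr.diff hΩ hx) (hpos x hx).ne', dirDeriv_const, add_zero]
    simp only [← pd_eq_dirDeriv]
  rw [metricInv_eq]
  simp only [e2, e1, weightedLaplacian]
  rw [← Finset.sum_neg_distrib, Finset.sum_mul, ← Finset.sum_neg_distrib, Finset.mul_sum,
    ← Finset.sum_add_distrib]
  refine Finset.sum_congr rfl fun i _ => ?_
  have := (hpos x hx).ne'
  field_simp
  ring

/-- Integration by parts for the second derivative of the relative entropy along a Wasserstein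
geodesic. -/
theorem integral_metricInv_mul_weightedLaplacian (hΩ : IsOpen Ω) (hK : IsCompact K) (hKΩ : K ⊆ Ω)
    {f ρ Φ : Rd d → ℝ} (hf : SmoothOn Ω f) (hρ : SmoothOn Ω ρ) (hΦ : SmoothOn Ω Φ)
    (hΦK : VanishesOff Ω K Φ) :
    ∫ x in Ω, (metricInv ρ Φ x * -weightedLaplacian f Φ x
        + ρ x * -weightedLaplacian f (fun y => -(1 / 2 * ∑ j, pd j Φ y ^ 2)) x)
      = ∫ x in Ω, ((∑ i, ∑ j, hessian Φ x i j ^ 2)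
          + inner ℝ (gradient Φ x) (hessianMulGradient f Φ x)) * ρ x := by
  have h1 : ∀ i, SmoothOn Ω (pd i Φ) := fun i => hΦ.pd hΩ i
  have h2 : ∀ i j, SmoothOn Ω (pd i (pd j Φ)) := fun i j => (h1 j).pd hΩ i
  have k1 : ∀ i, VanishesOff Ω K (pd i Φ) := fun i => hΦK.pd hΩ hK i
  have hL := hf.weightedLaplacian hΩ hΦ
  have hv : ∀ i, SmoothOn Ω fun x => ρ x * pd i Φ x := fun i => hρ.mul (h1 i)
  have key : ∀ x, ((∑ i, ∑ j, hessian Φ x i j ^ 2)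
      + inner ℝ (gradient Φ x) (hessianMulGradient f Φ x)) * ρ x
      = (∑ i, ∑ j, pd i (pd j Φ) x ^ 2
        + ∑ i, ∑ j, pd i Φ x * (pd i (pd j f) x * pd j Φ x)) * ρ x := by
    intro x
    rw [inner_gradient_hessianMulGradient]
    simp [hessian]
  simp only [key]
  refine setIntegral_eq_of_eq_add_divergence hΩ hK hKΩ
    -- This flux moves the divergence from ρ∇Φ onto LΦ, leaving ρ times the left side of Bochner's
    -- formula.
    (v := fun i x => (ρ x * pd i Φ x) * weightedLaplacian f Φ x) ?_ ?_
    (fun i => (hv i).mul hL) (fun i => ((k1 i).mul_left ρ).mul_right _) fun x hx => ?_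
  · refine ContDiffOn.continuousOn (SmoothOn.mul (SmoothOn.add ?_ ?_) hρ)
    · exact SmoothOn.sum fun i _ => SmoothOn.sum fun j _ => (h2 i j).sq
    · exact SmoothOn.sum fun i _ => SmoothOn.sum fun j _ =>
        (h1 i).mul (((hf.pd hΩ j).pd hΩ i).mul (h1 j))
  · refine VanishesOff.mul_right (VanishesOff.add ?_ ?_) ρ
    · refine VanishesOff.sum fun i _ => VanishesOff.sum fun j _ => ?_
      simp only [pow_two]
      exact ((k1 j).pd hΩ hK i).mul_right _
    · exact VanishesOff.sum fun i _ => VanishesOff.sum fun j _ => (k1 i).mul_right _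
  · have e1 : ∀ i, pd i (fun x => (ρ x * pd i Φ x) * weightedLaplacian f Φ x) x
        = pd i (fun x => ρ x * pd i Φ x) x * weightedLaplacian f Φ x
          + ρ x * (pd i Φ x * pd i (weightedLaplacian f Φ) x) := by
      intro i
      change dirDeriv _ _ _ = _
      rw [dirDeriv_mul _ ((hv i).diff hΩ hx) (hL.diff hΩ hx), ← pd_eq_dirDeriv]
      ring
    rw [← bochner_weightedLaplacian hΩ hf hΦ hx, metricInv_eq]
    simp only [e1, Finset.sum_add_distrib, ← Finset.sum_mul, ← Finset.mul_sum]
    ring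

end WeightedLaplacian

/-! ### First derivative, first variation and gradient of the relative entropy -/

section RelativeEntropy

variable {d : ℕ} {Ω K : Set (Rd d)} {f : Rd d → ℝ}

theorem IsDensity.nonempty {ρ : Rd d → ℝ} (hρ : IsDensity Ω ρ) : Ω.Nonempty := by
  by_contra h
  have := hρ.integral_eq_one
  simp [not_nonempty_iff_eq_empty.1 h] at this

/-- The logarithm of the normalization constant of the target density. -/
noncomputable def logPartition (Ω : Set (Rd d)) (f : Rd d → ℝ) : ℝ :=
  Real.log (∫ y in Ω, Real.exp (-f y))

theorem partition_pos (hΩ : IsOpen Ω) (hne : Ω.Nonempty)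
    (hZ : IntegrableOn (fun x => Real.exp (-f x)) Ω) : 0 < ∫ y in Ω, Real.exp (-f y) := by
  have : NeZero (volume.restrict Ω) :=
    ⟨fun h => (hΩ.measure_pos volume hne).ne' (Measure.restrict_eq_zero.1 h)⟩
  exact integral_exp_pos hZ

/-- The normalization of the target enters the integrand only through an additive constant. -/
theorem log_div_targetDensity (hΩ : IsOpen Ω) (hne : Ω.Nonempty)
    (hZ : IntegrableOn (fun x => Real.exp (-f x)) Ω) {a : ℝ} (ha : 0 < a) (x : Rd d) :
    Real.log (a / targetDensity Ω f x) = Real.log a + f x + logPartition Ω f := by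
  have hp := partition_pos hΩ hne hZ
  rw [targetDensity, Real.log_div ha.ne' (div_pos (Real.exp_pos _) hp).ne',
    Real.log_div (Real.exp_pos _).ne' hp.ne', Real.log_exp, logPartition]
  ring

theorem KL_eq_integral (hΩ : IsOpen Ω) (hne : Ω.Nonempty)
    (hZ : IntegrableOn (fun x => Real.exp (-f x)) Ω) {r : Rd d → ℝ} (hr : ∀ x ∈ Ω, 0 < r x) :
    KL Ω f r = ∫ x in Ω, r x * (Real.log (r x) + f x + logPartition Ω f) :=
  setIntegral_congr_fun hΩ.measurableSet fun x hx => by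
    simp only [log_div_targetDensity hΩ hne hZ (hr x hx)]

theorem FiniteKL.integrableOn (hΩ : IsOpen Ω) (hne : Ω.Nonempty)
    (hZ : IntegrableOn (fun x => Real.exp (-f x)) Ω) {r : Rd d → ℝ} (hr : ∀ x ∈ Ω, 0 < r x)
    (h : FiniteKL Ω f r) :
    IntegrableOn (fun x => r x * (Real.log (r x) + f x + logPartition Ω f)) Ω :=
  (integrableOn_congr_fun (fun x hx => by
    simp only [log_div_targetDensity hΩ hne hZ (hr x hx)]) hΩ.measurableSet).1 h

theorem vanishesOff_dirDeriv_time (hΩ : IsOpen Ω) {J : Set ℝ} (hJ : IsOpen J) {h : ℝ × Rd d → ℝ}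
    (hh : ContDiffOn ℝ ∞ h (J ×ˢ Ω)) {g : Rd d → ℝ}
    (hg : ∀ s ∈ J, ∀ x ∈ Ω \ K, h (s, x) = g x) :
    ∀ s ∈ J, VanishesOff Ω K fun x => dirDeriv ((1 : ℝ), (0 : Rd d)) h (s, x) := by
  intro s hs x hx
  have h1 := hasDerivAt_slice (hh.differentiableAt_of_isOpen (hJ.prod hΩ) (x := (s, x)) ⟨hs, hx.1⟩)
  refine h1.unique ((hasDerivAt_const s (g x)).congr_of_eventuallyEq ?_)
  filter_upwards [hJ.mem_nhds hs] with t ht using hg t ht x hx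

/-- The derivative of the relative entropy along a curve of positive densities that is constant in
time outside a compact set. -/
theorem hasDerivAt_KL (hΩ : IsOpen Ω) (hf : SmoothOn Ω f)
    (hZ : IntegrableOn (fun x => Real.exp (-f x)) Ω) (hK : IsCompact K) (hKΩ : K ⊆ Ω)
    {ρ : Rd d → ℝ} (hρ : IsDensity Ω ρ) (hfin : FiniteKL Ω f ρ)
    {J : Set ℝ} (hJ : IsOpen J) {r : ℝ → Rd d → ℝ}
    (hr : ContDiffOn ℝ ∞ (fun p : ℝ × Rd d => r p.1 p.2) (J ×ˢ Ω))
    (hpos : ∀ s ∈ J, ∀ x ∈ Ω, 0 < r s x) (hoff : ∀ s ∈ J, ∀ x ∈ Ω \ K, r s x = ρ x)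
    {r' : Rd d → ℝ} {s : ℝ} (hs : s ∈ J)
    (hr' : ∀ x ∈ Ω, HasDerivAt (fun t => r t x) (r' x) s) :
    HasDerivAt (fun t => KL Ω f (r t))
      (∫ x in Ω, r' x * (Real.log (r s x) + f x + logPartition Ω f + 1)) s := by
  have hne := hρ.nonempty
  set c := logPartition Ω f
  have hU : IsOpen (J ×ˢ Ω) := hJ.prod hΩ
  set h : ℝ × Rd d → ℝ := fun p => r p.1 p.2 * (Real.log (r p.1 p.2) + f p.2 + c) with hdef
  have hh : ContDiffOn ℝ ∞ h (J ×ˢ Ω) :=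
    hr.mul (((hr.log fun p hp => (hpos p.1 hp.1 p.2 hp.2).ne').add
      (hf.comp contDiffOn_snd fun p hp => hp.2)).add contDiffOn_const)
  have hoff' : ∀ t ∈ J, ∀ x ∈ Ω \ K, h (t, x) = ρ x * (Real.log (ρ x) + f x + c) := by
    intro t ht x hx
    simp only [hdef, hoff t ht x hx]
  have hρi := hfin.integrableOn hΩ hne hZ hρ.pos
  have hρs : SmoothOn Ω fun x => ρ x * (Real.log (ρ x) + f x + c) :=
    hρ.smooth.mul (((hρ.smooth.log hρ.pos).add hf).add (SmoothOn.const c))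
  -- Finiteness of E(ρ) propagates in time: the integrands at time s and at ρ differ by a continuous
  -- function vanishing off K.
  have hi : IntegrableOn (fun x => h (s, x)) Ω := by
    have hd : IntegrableOn (fun x => h (s, x) - ρ x * (Real.log (ρ x) + f x + c)) Ω :=
      VanishesOff.integrableOn hΩ hK hKΩ (fun x hx => by simp [hoff' s hs x hx])
        ((hh.slice hs).continuousOn.sub hρs.continuousOn)
    refine (hd.add hρi).congr (Eventually.of_forall fun x => ?_)
    simp [c]
  have key := hasDerivAt_setIntegral hΩ hK hKΩ hJ hh (vanishesOff_dirDeriv_time hΩ hJ hh hoff')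
    hs hi
  have heq : ∫ x in Ω, dirDeriv ((1 : ℝ), (0 : Rd d)) h (s, x)
      = ∫ x in Ω, r' x * (Real.log (r s x) + f x + c + 1) := by
    refine setIntegral_congr_fun hΩ.measurableSet fun x hx => ?_
    have h1 := hasDerivAt_slice (hh.differentiableAt_of_isOpen hU (x := (s, x)) ⟨hs, hx⟩)
    have hp := (hpos s hs x hx).ne'
    have h2 := (hr' x hx).mul ((((hr' x hx).log hp).add_const (f x)).add_const c)
    refine (h1.unique h2).trans ?_
    field_simp
  rw [heq] at key
  refine key.congr_of_eventuallyEq ?_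
  filter_upwards [hJ.mem_nhds hs] with t ht using KL_eq_integral hΩ hne hZ (hpos t ht)

theorem exists_pos_of_add_smul_test {ρ σ : Rd d → ℝ} (hρ : IsDensity Ω ρ) (hσ : IsTest Ω σ) :
    ∃ δ > 0, ∀ s ∈ Ioo (-δ) δ, ∀ x ∈ Ω, 0 < ρ x + s * σ x := by
  obtain ⟨m, hm, hmρ⟩ := hσ.2.1.isCompact.exists_forall_le' (a := 0)
    (hρ.smooth.continuousOn.mono hσ.2.2) fun x hx => hρ.pos x (hσ.2.2 hx)
  obtain ⟨M, hM⟩ := hσ.2.1.exists_bound_of_continuous hσ.1.continuous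
  have hM0 : 0 ≤ M := (norm_nonneg _).trans (hM 0)
  -- Here m > 0 bounds ρ from below on the support of σ and M bounds |σ|; M + 1 keeps the
  -- denominator positive and makes |sσ| < m.
  refine ⟨m / (M + 1), by positivity, fun s hs x hx => ?_⟩
  by_cases hxK : x ∈ tsupport σ
  · have h1 : |s * σ x| ≤ m / (M + 1) * M := by
      rw [abs_mul]
      exact mul_le_mul (abs_lt.2 hs).le (hM x) (abs_nonneg _) (by positivity)
    have h2 : m / (M + 1) * M < m := by
      rw [div_mul_eq_mul_div, div_lt_iff₀ (by positivity)]
      nlinarith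
    linarith [neg_abs_le (s * σ x), hmρ x hxK]
  · rw [image_eq_zero_of_notMem_tsupport hxK]
    simpa using hρ.pos x hx

/-- The first variation of the relative entropy. -/
theorem isFirstVariation_KL (hΩ : IsOpen Ω) (hf : SmoothOn Ω f)
    (hZ : IntegrableOn (fun x => Real.exp (-f x)) Ω)
    {ρ : Rd d → ℝ} (hρ : IsDensity Ω ρ) (hfin : FiniteKL Ω f ρ) :
    IsFirstVariation Ω (KL Ω f) ρ
      (fun x => Real.log (ρ x) + f x + (logPartition Ω f + 1)) := by
  refine ⟨((hρ.smooth.log hρ.pos).add hf).add (SmoothOn.const _), fun σ hσ _ => ?_⟩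
  obtain ⟨δ, hδ, hpos⟩ := exists_pos_of_add_smul_test hρ hσ
  have hr : ContDiffOn ℝ ∞ (fun p : ℝ × Rd d => ρ p.2 + p.1 * σ p.2) (Ioo (-δ) δ ×ˢ Ω) :=
    (hρ.smooth.comp contDiffOn_snd fun p hp => hp.2).add
      (contDiffOn_fst.mul (hσ.smoothOn.comp contDiffOn_snd fun p hp => hp.2))
  have := hasDerivAt_KL hΩ hf hZ hσ.2.1.isCompact hσ.2.2 hρ hfin isOpen_Ioo
    (r := fun s x => ρ x + s * σ x) (r' := σ) hr hpos
    (fun s _ x hx => by simp [hσ.vanishesOff x hx]) (s := 0) ⟨by linarith, hδ⟩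
    (fun x _ => by simpa using (hasDerivAt_mul_const (σ x)).const_add (ρ x))
  refine this.congr_deriv (integral_congr_ae (Eventually.of_forall fun x => ?_))
  simp only [zero_mul, add_zero]
  ring

/-- Two first variations of a functional differ by a locally constant function. -/
theorem IsFirstVariation.pd_eq (hΩ : IsOpen Ω) {E : (Rd d → ℝ) → ℝ} {ρ u w : Rd d → ℝ}
    (hu : IsFirstVariation Ω E ρ u) (hw : IsFirstVariation Ω E ρ w) (i : Fin d) :
    ∀ x ∈ Ω, pd i u x = pd i w x := by
  have hd : SmoothOn Ω fun x => u x - w x := hu.1.sub hw.1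
  have hz : ∀ x ∈ Ω, pd i (fun x => u x - w x) x = 0 := by
    refine eq_zero_of_forall_integral_test_mul_eq_zero hΩ (hd.pd hΩ i).continuousOn
      fun ψ hψ => ?_
    -- The direction ∂_iψ has mean zero for every test function ψ, so it is admissible; integrating
    -- by parts recovers ∂_i(u - w) tested against ψ.
    have hσ := hψ.pd i
    have hc := hψ.2.1.isCompact
    have hi : ∀ v : Rd d → ℝ, SmoothOn Ω v → IntegrableOn (fun x => v x * pd i ψ x) Ω :=
      fun v hv => ((hψ.vanishesOff.pd hΩ hc i).mul_left v).integrableOn hΩ hc hψ.2.2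
        (hv.mul hσ.smoothOn).continuousOn
    have h0 : ∫ x in Ω, pd i ψ x = 0 :=
      hψ.vanishesOff.integral_pd_eq_zero hΩ hc hψ.2.2 hψ.smoothOn i
    have h1 := (hu.2 _ hσ h0).unique (hw.2 _ hσ h0)
    have h2 : ∫ x in Ω, (u x - w x) * pd i ψ x = 0 := by
      simp only [sub_mul]
      rw [integral_sub (hi u hu.1) (hi w hw.1), h1, sub_self]
    have h3 := (hψ.vanishesOff.mul_left fun x => u x - w x).integral_pd_eq_zero hΩ hc hψ.2.2
      (hd.mul hψ.smoothOn) i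
    have h4 : ∀ x ∈ Ω, pd i (fun x => (u x - w x) * ψ x) x
        = ψ x * pd i (fun x => u x - w x) x + (u x - w x) * pd i ψ x := by
      intro x hx
      change dirDeriv _ _ _ = _
      rw [dirDeriv_mul _ (hd.diff hΩ hx) (hψ.smoothOn.diff hΩ hx), ← pd_eq_dirDeriv, mul_comm]
    rw [setIntegral_congr_fun hΩ.measurableSet h4, integral_add
      ((hψ.vanishesOff.mul_right _).integrableOn hΩ hc hψ.2.2
        (hψ.smoothOn.mul (hd.pd hΩ i)).continuousOn) (hi _ hd), h2, add_zero] at h3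
    exact h3
  intro x hx
  have := hz x hx
  rw [show pd i (fun x => u x - w x) x = pd i u x - pd i w x from
    dirDeriv_sub _ (hu.1.diff hΩ hx) (hw.1.diff hΩ hx)] at this
  linarith

/-- Since ρ∇log ρ = ∇ρ, the entropy part of the gradient is linear in ρ. -/
theorem metricInv_log_add (hΩ : IsOpen Ω) (hf : SmoothOn Ω f) {ρ : Rd d → ℝ}
    (hρ : IsDensity Ω ρ) (c : ℝ) :
    ∀ x ∈ Ω, metricInv ρ (fun x => Real.log (ρ x) + f x + c) x
      = -(divergence (fun y => ρ y • gradient f y) x + Laplacian.laplacian ρ x) := by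
  intro x hx
  have hl := hρ.smooth.log hρ.pos
  rw [metricInv_eq, divergence_smul_gradient, laplacian_eq_sum_pd hΩ hρ.smooth hx,
    ← Finset.sum_add_distrib, neg_inj]
  refine Finset.sum_congr rfl fun i _ => ?_
  have h1 : ∀ y ∈ Ω, ρ y * pd i (fun x => Real.log (ρ x) + f x + c) y
      = ρ y * pd i f y + pd i ρ y := by
    intro y hy
    rw [show pd i (fun x => Real.log (ρ x) + f x + c) y = (ρ y)⁻¹ * pd i ρ y + pd i f y by
      change dirDeriv _ _ _ = _
      rw [dirDeriv_add _ ((hl.add hf).diff hΩ hy) (differentiableAt_const c),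
        dirDeriv_add _ (hl.diff hΩ hy) (hf.diff hΩ hy),
        dirDeriv_log _ (hρ.smooth.diff hΩ hy) (hρ.pos y hy).ne', dirDeriv_const, add_zero,
        ← pd_eq_dirDeriv]]
    have := (hρ.pos y hy).ne'
    field_simp
    ring
  rw [pd_congr hΩ h1 i x hx]
  exact dirDeriv_add _ ((hρ.smooth.mul (hf.pd hΩ i)).diff hΩ hx) ((hρ.smooth.pd hΩ i).diff hΩ hx)

/-- The Wasserstein gradient of the relative entropy is `-∇·(ρ∇f) - Δρ`. -/
theorem isWassersteinGradient_KL_iff (hΩ : IsOpen Ω) (hf : SmoothOn Ω f)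
    (hZ : IntegrableOn (fun x => Real.exp (-f x)) Ω)
    {ρ : Rd d → ℝ} (hρ : IsDensity Ω ρ) (hfin : FiniteKL Ω f ρ) {τ : Rd d → ℝ} :
    IsWassersteinGradient Ω (KL Ω f) ρ τ ↔ ∀ x ∈ Ω, τ x
      = -(divergence (fun y => ρ y • gradient f y) x + Laplacian.laplacian ρ x) := by
  have hfv := isFirstVariation_KL hΩ hf hZ hρ hfin
  have hm := metricInv_log_add hΩ hf hρ (logPartition Ω f + 1)
  refine ⟨fun ⟨u, hu, hτ⟩ x hx => ?_, fun h => ⟨_, hfv, fun x hx => by rw [hm x hx, h x hx]⟩⟩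
  rw [hτ x hx, ← hm x hx, metricInv_eq, metricInv_eq]
  congr 1
  -- The gradient sees only ∇u, so the locally constant ambiguity of the first variation is
  -- harmless.
  exact Finset.sum_congr rfl fun i _ =>
    pd_congr hΩ (fun y hy => by rw [hu.pd_eq hΩ hfv i y hy]) i x hx

end RelativeEntropy

/-! ### Second derivative of the relative entropy along a geodesic -/

section Geodesics

variable {d : ℕ} {Ω : Set (Rd d)} {f : Rd d → ℝ}

/-- The second derivative of the relative entropy along a Wasserstein geodesic. -/
theorem IsWassersteinGeodesic.hasSecondDerivAt_KL (hΩ : IsOpen Ω) (hf : SmoothOn Ω f)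
    (hZ : IntegrableOn (fun x => Real.exp (-f x)) Ω)
    {ρ Φ : Rd d → ℝ} (hρ : IsDensity Ω ρ) (hfin : FiniteKL Ω f ρ)
    (hΦ : SmoothOn Ω Φ) {r φ : ℝ → Rd d → ℝ} (hgeo : IsWassersteinGeodesic Ω ρ Φ r φ) :
    HasSecondDerivAt (fun s => KL Ω f (r s))
      (∫ x in Ω, ((∑ i, ∑ j, hessian Φ x i j ^ 2)
        + inner ℝ (gradient Φ x) (hessianMulGradient f Φ x)) * ρ x) 0 := by
  obtain ⟨ε, hε, K, hKΩ, hK, hR, hP, h0, hg⟩ := hgeo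
  set J := Ioo (-ε) ε
  have hJ : IsOpen J := isOpen_Ioo
  have h0J : (0 : ℝ) ∈ J := ⟨by linarith, hε⟩
  have hU : IsOpen (J ×ˢ Ω) := hJ.prod hΩ
  have hφK : ∀ s ∈ J, VanishesOff Ω K (φ s) := fun s hs => (hg s hs).2.1
  have hφs : ∀ s ∈ J, SmoothOn Ω (φ s) := fun s hs => hP.slice hs
  have hrs : ∀ s ∈ J, SmoothOn Ω (r s) := fun s hs => hR.slice hs
  have hmK : ∀ s ∈ J, VanishesOff Ω K (metricInv (r s) (φ s)) := by
    intro s hs x hx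
    rw [metricInv_eq, neg_eq_zero]
    exact VanishesOff.sum
      (fun i _ => (((hφK s hs).pd hΩ hK i).mul_left (r s)).pd hΩ hK i) x hx
  -- Off K the potential, and with it the velocity, is zero, so the density is frozen at its initial
  -- value.
  have hoff : ∀ s ∈ J, ∀ x ∈ Ω \ K, r s x = ρ x := by
    intro s hs x hx
    rw [← (h0 x hx.1).1]
    refine (convex_Ioo (-ε) ε).is_const_of_fderivWithin_eq_zero (𝕜 := ℝ) (f := fun t => r t x)
      (fun t ht => ((hg t ht).2.2 x hx.1).1.differentiableAt.differentiableWithinAt) ?_ hs h0J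
    intro t ht
    have h1 := ((hg t ht).2.2 x hx.1).1
    rw [hmK t ht x hx] at h1
    rw [h1.hasFDerivAt.hasFDerivWithinAt.fderivWithin (hJ.uniqueDiffWithinAt ht)]
    ext
    simp
  have hE : ∀ s ∈ J, HasDerivAt (fun t => KL Ω f (r t))
      (∫ x in Ω, r s x * -weightedLaplacian f (φ s) x) s := by
    intro s hs
    rw [← integral_metricInv_mul_log hΩ hK hKΩ hf (hrs s hs) (hg s hs).1.pos (hφs s hs) (hφK s hs)
      (logPartition Ω f)]
    exact hasDerivAt_KL hΩ hf hZ hK hKΩ hρ hfin hJ hR (fun t ht => (hg t ht).1.pos) hoff hs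
      fun x hx => ((hg s hs).2.2 x hx).1
  refine ⟨?_, ?_⟩
  · filter_upwards [hJ.mem_nhds h0J] with s hs using (hE s hs).differentiableAt
  set P : ℝ × Rd d → ℝ := fun p => φ p.1 p.2 with hPdef
  set e : Fin d → ℝ × Rd d := fun i => ((0 : ℝ), EuclideanSpace.single i (1 : ℝ)) with hedef
  set τ : ℝ × Rd d := ((1 : ℝ), (0 : Rd d)) with hτdef
  have hsl : ∀ {h : ℝ × Rd d → ℝ}, ContDiffOn ℝ ∞ h (J ×ˢ Ω) → ∀ s ∈ J, ∀ x ∈ Ω, ∀ i,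
      pd i (fun y => h (s, y)) x = dirDeriv (e i) h (s, x) := fun hh s hs x hx i =>
    dirDeriv_slice (hh.differentiableAt_of_isOpen hU ⟨hs, hx⟩) _
  have hsl2 : ∀ {h : ℝ × Rd d → ℝ}, ContDiffOn ℝ ∞ h (J ×ˢ Ω) → ∀ s ∈ J, ∀ x ∈ Ω, ∀ i,
      pd i (pd i (fun y => h (s, y))) x = dirDeriv (e i) (dirDeriv (e i) h) (s, x) := by
    intro h hh s hs x hx i
    rw [pd_congr hΩ (fun y hy => hsl hh s hs y hy i) i x hx, hsl (hh.dirDeriv hU _) s hs x hx]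
  -- G is s ↦ Lφ_s written with derivatives on space-time, so that it is jointly smooth and can be
  -- differentiated in s.
  set G : ℝ × Rd d → ℝ := fun p =>
    ∑ i, (dirDeriv (e i) (dirDeriv (e i) P) p - pd i f p.2 * dirDeriv (e i) P p) with hGdef
  have hfp : ∀ i, ContDiffOn ℝ ∞ (fun p : ℝ × Rd d => pd i f p.2) (J ×ˢ Ω) := fun i =>
    ContDiffOn.comp (hf.pd hΩ i) contDiffOn_snd fun p hp => hp.2
  have hPi : ∀ i, ContDiffOn ℝ ∞ (dirDeriv (e i) P) (J ×ˢ Ω) := fun i => hP.dirDeriv hU _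
  have hPii : ∀ i, ContDiffOn ℝ ∞ (dirDeriv (e i) (dirDeriv (e i) P)) (J ×ˢ Ω) :=
    fun i => (hPi i).dirDeriv hU _
  have hGs : ContDiffOn ℝ ∞ G (J ×ˢ Ω) :=
    ContDiffOn.sum fun i _ => (hPii i).sub ((hfp i).mul (hPi i))
  have hGeq : ∀ s ∈ J, ∀ x ∈ Ω, G (s, x) = weightedLaplacian f (φ s) x := by
    intro s hs x hx
    refine Finset.sum_congr rfl fun i _ => ?_
    rw [← hsl hP s hs x hx, ← hsl2 hP s hs x hx]
  have hh : ContDiffOn ℝ ∞ (fun p : ℝ × Rd d => r p.1 p.2 * -G p) (J ×ˢ Ω) := hR.mul hGs.neg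
  have hhK : ∀ s ∈ J, ∀ x ∈ Ω \ K, r s x * -G (s, x) = 0 := by
    intro s hs x hx
    rw [hGeq s hs x hx.1, (hφK s hs).weightedLaplacian hΩ hK f x hx]
    simp
  have hkey := hasDerivAt_setIntegral hΩ hK hKΩ hJ hh
    (vanishesOff_dirDeriv_time hΩ hJ hh (g := fun _ => 0) hhK) h0J
    (VanishesOff.integrableOn hΩ hK hKΩ (hhK 0 h0J) (hh.slice h0J).continuousOn)
  have hPt : ∀ x ∈ Ω, dirDeriv τ P (0, x) = -(1 / 2 * ∑ j, pd j Φ x ^ 2) := by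
    intro x hx
    have h1 := hasDerivAt_slice (hP.differentiableAt_of_isOpen hU (x := (0, x)) ⟨h0J, hx⟩)
    rw [h1.unique ((hg 0 h0J).2.2 x hx).2, norm_gradient_sq]
    simp only [pd_congr hΩ (fun y hy => (h0 y hy).2) _ x hx]
  -- Time and space derivatives commute and f does not depend on time, so ∂_s(Lφ) = L(∂_sφ); the
  -- Hamilton-Jacobi equation supplies ∂_sφ.
  have hGt : ∀ x ∈ Ω, dirDeriv τ G (0, x)
      = weightedLaplacian f (fun y => -(1 / 2 * ∑ j, pd j Φ y ^ 2)) x := by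
    intro x hx
    have hx' : ((0 : ℝ), x) ∈ J ×ˢ Ω := ⟨h0J, hx⟩
    rw [← weightedLaplacian_congr hΩ f hPt x hx, hGdef, dirDeriv_sum _ _ fun i _ =>
      ((hPii i).sub ((hfp i).mul (hPi i))).differentiableAt_of_isOpen hU hx']
    refine Finset.sum_congr rfl fun i _ => ?_
    have hft : dirDeriv τ (fun p : ℝ × Rd d => pd i f p.2) (0, x) = 0 :=
      (hasDerivAt_slice ((hfp i).differentiableAt_of_isOpen hU hx')).unique
        (hasDerivAt_const (0 : ℝ) (pd i f x))
    rw [dirDeriv_sub _ ((hPii i).differentiableAt_of_isOpen hU hx')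
        (((hfp i).mul (hPi i)).differentiableAt_of_isOpen hU hx'),
      dirDeriv_mul _ ((hfp i).differentiableAt_of_isOpen hU hx')
        ((hPi i).differentiableAt_of_isOpen hU hx'), hft,
      dirDeriv_comm hU (hPi i) τ (e i) hx',
      dirDeriv_congr hU (fun p hp => dirDeriv_comm hU hP τ (e i) hp) (e i) hx',
      dirDeriv_comm hU hP τ (e i) hx', hsl2 (hP.dirDeriv hU τ) 0 h0J x hx i,
      hsl (hP.dirDeriv hU τ) 0 h0J x hx i]
    ring
  have hint : ∫ x in Ω, dirDeriv τ (fun p : ℝ × Rd d => r p.1 p.2 * -G p) (0, x)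
      = ∫ x in Ω, (metricInv ρ Φ x * -weightedLaplacian f Φ x
        + ρ x * -weightedLaplacian f (fun y => -(1 / 2 * ∑ j, pd j Φ y ^ 2)) x) := by
    refine setIntegral_congr_fun hΩ.measurableSet fun x hx => ?_
    have hx' : ((0 : ℝ), x) ∈ J ×ˢ Ω := ⟨h0J, hx⟩
    have hRt : dirDeriv τ (fun p : ℝ × Rd d => r p.1 p.2) (0, x) = metricInv ρ Φ x := by
      have h1 := hasDerivAt_slice (hR.differentiableAt_of_isOpen hU hx')
      rw [h1.unique ((hg 0 h0J).2.2 x hx).1, metricInv_eq, metricInv_eq]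
      congr 1
      refine Finset.sum_congr rfl fun i _ => pd_congr hΩ (fun y hy => ?_) i x hx
      rw [(h0 y hy).1, pd_congr hΩ (fun z hz => (h0 z hz).2) i y hy]
    rw [dirDeriv_mul _ (hR.differentiableAt_of_isOpen hU hx')
      (hGs.neg.differentiableAt_of_isOpen hU hx'), hRt, dirDeriv_neg, hGt x hx, hGeq 0 h0J x hx,
      weightedLaplacian_congr hΩ f (fun y hy => (h0 y hy).2) x hx, (h0 x hx).1]
  have hΦK : VanishesOff Ω K Φ := fun x hx => by
    rw [← (h0 x hx.1).2, hφK 0 h0J x hx]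
  rw [← integral_metricInv_mul_weightedLaplacian hΩ hK hKΩ hf hρ.smooth hΦ hΦK, ← hint]
  -- The first-derivative formula holds for all s near 0, so differentiating it at 0 gives the
  -- second derivative.
  refine hkey.congr_of_eventuallyEq ?_
  filter_upwards [hJ.mem_nhds h0J] with s hs
  rw [(hE s hs).deriv]
  exact setIntegral_congr_fun hΩ.measurableSet fun x hx => by simp only [hGeq s hs x hx]

end Geodesics

/-! ### Perturbations of the identity and their smooth inverses -/

section Displacement

variable {E : Type*} [NormedAddCommGroup E] [NormedSpace ℝ E]

/-- The displacement `x ↦ x + s V(x)` along a vector field. -/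
def displacement (V : E → E) (s : ℝ) (x : E) : E := x + s • V x

/-- The inverse `(s, y) ↦ X_s⁻¹(y)` of the displacement along a vector field. -/
noncomputable def displacementInv [Nonempty E] (V : E → E) (p : ℝ × E) : E :=
  Function.invFun (displacement V p.1) p.2

variable {V : E → E} {C : NNReal} {s : ℝ}

/-- If x and y have the same image, then x - y = s(V y - V x), and sV is a strict contraction. -/
theorem displacement_injective (hC : LipschitzWith C V) (hs : |s| * C < 1) :
    Function.Injective (displacement V s) := by
  intro x y hxy
  have h1 : x - y = s • (V y - V x) := by
    simp only [displacement] at hxy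
    rw [smul_sub, sub_eq_sub_iff_add_eq_add, hxy, add_comm]
  have h2 : ‖x - y‖ ≤ |s| * C * ‖x - y‖ := by
    calc ‖x - y‖ = |s| * ‖V y - V x‖ := by
          conv_lhs => rw [h1]
          rw [norm_smul, Real.norm_eq_abs]
      _ ≤ |s| * (C * ‖y - x‖) := by gcongr; exact hC.norm_sub_le y x
      _ = |s| * C * ‖x - y‖ := by rw [norm_sub_rev y x]; ring
  have h3 : ‖x - y‖ = 0 := by nlinarith [norm_nonneg (x - y)]
  exact sub_eq_zero.1 (norm_eq_zero.1 h3)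

/-- A preimage of y is a fixed point of the contraction x ↦ y - sV(x). -/
theorem displacement_surjective [CompleteSpace E] (hC : LipschitzWith C V) (hs : |s| * C < 1) :
    Function.Surjective (displacement V s) := by
  intro y
  have hl : LipschitzWith (‖s‖₊ * C) fun x => y - s • V x := by
    refine LipschitzWith.of_dist_le_mul fun a b => ?_
    rw [dist_eq_norm, sub_sub_sub_cancel_left, ← smul_sub, norm_smul, NNReal.coe_mul, coe_nnnorm,
      mul_assoc, dist_comm, dist_eq_norm]
    gcongr
    exact hC.norm_sub_le b a
  have hc : ContractingWith (‖s‖₊ * C) fun x => y - s • V x := by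
    refine ⟨?_, hl⟩
    rw [← NNReal.coe_lt_coe]
    simpa using hs
  refine ⟨hc.fixedPoint, ?_⟩
  have h : y - s • V hc.fixedPoint = hc.fixedPoint := hc.fixedPoint_isFixedPt
  rw [displacement, ← sub_eq_iff_eq_add.1 h]

theorem displacementInv_displacement (hC : LipschitzWith C V) (hs : |s| * C < 1) (x : E) :
    displacementInv V (s, displacement V s x) = x :=
  Function.leftInverse_invFun (displacement_injective hC hs) x

theorem displacement_displacementInv [CompleteSpace E] (hC : LipschitzWith C V)
    (hs : |s| * C < 1) (y : E) : displacement V s (displacementInv V (s, y)) = y :=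
  Function.rightInverse_invFun (displacement_surjective hC hs) y

theorem hasFDerivAt_displacement (hV : ContDiff ℝ ∞ V) (s : ℝ) (x : E) :
    HasFDerivAt (displacement V s) (ContinuousLinearMap.id ℝ E + s • fderiv ℝ V x) x :=
  (hasFDerivAt_id x).add ((hV.differentiable (by simp) x).hasFDerivAt.const_smul s)

/-- The infinitesimal form of injectivity: ‖DV‖ ≤ C, so s DV is a strict contraction as well. -/
theorem eq_zero_of_add_smul_fderiv_eq_zero (hC : LipschitzWith C V) (hs : |s| * C < 1) {x v : E}
    (h : v + s • fderiv ℝ V x v = 0) : v = 0 := by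
  have h2 : ‖v‖ ≤ |s| * C * ‖v‖ := by
    calc ‖v‖ = |s| * ‖fderiv ℝ V x v‖ := by
          conv_lhs => rw [eq_neg_of_add_eq_zero_left h]
          rw [norm_neg, norm_smul, Real.norm_eq_abs]
      _ ≤ |s| * (C * ‖v‖) := by
          gcongr
          exact (fderiv ℝ V x).le_of_opNorm_le (norm_fderiv_le_of_lipschitz ℝ hC) v
      _ = |s| * C * ‖v‖ := by ring
  have h3 : ‖v‖ = 0 := by nlinarith [norm_nonneg v]
  exact norm_eq_zero.1 h3

variable [FiniteDimensional ℝ E]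

theorem exists_add_smul_fderiv_eq (hC : LipschitzWith C V) (hs : |s| * C < 1) (x w : E) :
    ∃ v, v + s • fderiv ℝ V x v = w := by
  have hinj : Function.Injective
      ((ContinuousLinearMap.id ℝ E + s • fderiv ℝ V x : E →L[ℝ] E) : E →ₗ[ℝ] E) := by
    rw [injective_iff_map_eq_zero]
    intro v hv
    exact eq_zero_of_add_smul_fderiv_eq_zero hC hs (x := x) (by simpa using hv)
  obtain ⟨v, hv⟩ := LinearMap.surjective_of_injective hinj w
  exact ⟨v, by simpa using hv⟩

/-- The inverse function theorem is applied to (s, x) ↦ (s, X_s x), which gives smoothness jointly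
in time and space. The derivative is block triangular, hence injective, hence invertible in finite
dimension. -/
theorem contDiffAt_displacementInv (hV : ContDiff ℝ ∞ V) (hC : LipschitzWith C V)
    (hs : |s| * C < 1) (y : E) : ContDiffAt ℝ ∞ (displacementInv V) (s, y) := by
  have : CompleteSpace E := FiniteDimensional.complete ℝ E
  obtain ⟨x, rfl⟩ := displacement_surjective hC hs y
  set F : ℝ × E → ℝ × E := fun p => (p.1, displacement V p.1 p.2) with hFdef
  have hF : ContDiff ℝ ∞ F :=
    contDiff_fst.prodMk (contDiff_snd.add (contDiff_fst.smul (hV.comp contDiff_snd)))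
  have hFd : HasFDerivAt F (fderiv ℝ F (s, x)) (s, x) :=
    (hF.differentiable (by simp) _).hasFDerivAt
  have hFx : ∀ q : ℝ × E, fderiv ℝ F (s, x) q = (q.1, q.2 + (s • fderiv ℝ V x q.2 + q.1 • V x)) := by
    intro q
    have hVx : HasFDerivAt (fun p : ℝ × E => V p.2) _ (s, x) :=
      HasFDerivAt.comp (s, x) (hV.differentiable (by simp) x).hasFDerivAt hasFDerivAt_snd
    have h : HasFDerivAt F _ (s, x) :=
      hasFDerivAt_fst.prodMk (hasFDerivAt_snd.add (hasFDerivAt_fst.smul hVx))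
    rw [h.fderiv]
    simp
  have hinj : Function.Injective (fderiv ℝ F (s, x) : ℝ × E →ₗ[ℝ] ℝ × E) := by
    rw [injective_iff_map_eq_zero]
    intro q hq
    have hq' : fderiv ℝ F (s, x) q = 0 := hq
    rw [hFx q, Prod.mk_eq_zero] at hq'
    obtain ⟨h1, h2⟩ := hq'
    rw [h1, zero_smul, add_zero] at h2
    exact Prod.ext h1 (eq_zero_of_add_smul_fderiv_eq_zero hC hs h2)
  set L : (ℝ × E) ≃L[ℝ] ℝ × E :=
    (LinearEquiv.ofInjectiveEndo _ hinj).toContinuousLinearEquiv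
  have hL : (L : ℝ × E →L[ℝ] ℝ × E) = fderiv ℝ F (s, x) := by
    ext q <;> rfl
  have hFL : HasFDerivAt F (L : ℝ × E →L[ℝ] ℝ × E) (s, x) := by rw [hL]; exact hFd
  have hinv := hF.contDiffAt.to_localInverse hFL (by simp)
  have hright : ∀ᶠ p in 𝓝 (F (s, x)), F (hF.contDiffAt.localInverse hFL (by simp) p) = p :=
    (hF.contDiffAt.hasStrictFDerivAt' hFL (by simp)).eventually_right_inverse
  refine (contDiff_snd.contDiffAt.comp _ hinv).congr_of_eventuallyEq ?_
  -- The smallness condition persists for nearby times, where injectivity identifies the local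
  -- inverse with the global one.
  have hopen : ∀ᶠ p in 𝓝 (F (s, x)), |p.1| * (C : ℝ) < 1 :=
    (isOpen_lt (by fun_prop) continuous_const).mem_nhds hs
  filter_upwards [hright, hopen] with p hp hps
  set q := hF.contDiffAt.localInverse hFL (by simp) p
  have h1 : q.1 = p.1 := (Prod.ext_iff.1 hp).1
  have h2 : displacement V q.1 q.2 = p.2 := (Prod.ext_iff.1 hp).2
  rw [h1] at h2
  rw [Function.comp_apply, ← displacementInv_displacement hC hps q.2, h2]

end Displacement

/-! ### Derivative and sign of det(1 + tA) -/

section Determinants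

open Matrix

variable {n : Type*} [Fintype n] [DecidableEq n]

theorem hasDerivAt_det_one_add_smul_zero (M : Matrix n n ℝ) :
    HasDerivAt (fun t : ℝ => (1 + t • M).det) M.trace 0 := by
  have h : (fun t : ℝ => (1 + t • M).det) = fun t => 1 + M.trace * t
      + (det (1 + (Polynomial.X : Polynomial ℝ) • M.map Polynomial.C)).divX.divX.eval t * t ^ 2 :=
    funext fun t => det_one_add_smul t M
  rw [h]
  have h1 := (((hasDerivAt_id (0 : ℝ)).const_mul M.trace).const_add 1).add
    ((Polynomial.hasDerivAt
      (det (1 + (Polynomial.X : Polynomial ℝ) • M.map Polynomial.C)).divX.divX 0).mul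
      (hasDerivAt_pow 2 (0 : ℝ)))
  refine h1.congr_deriv ?_
  simp

/-- Jacobi's formula for the determinant along the line `1 + tA`. -/
theorem hasDerivAt_det_one_add_smul {A B : Matrix n n ℝ} {s : ℝ} (h : B * (1 + s • A) = 1) :
    HasDerivAt (fun t : ℝ => (1 + t • A).det) ((1 + s • A).det * (B * A).trace) s := by
  have h' := mul_eq_one_comm.1 h
  -- The factorization 1 + tA = (1 + sA)(1 + (t - s)BA) reduces the claim to the derivative at the
  -- identity.
  have heq : (fun t : ℝ => (1 + t • A).det)
      = fun t => (1 + s • A).det * (1 + (t - s) • (B * A)).det := by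
    funext t
    rw [← det_mul, mul_add, mul_one, mul_smul_comm, ← mul_assoc, h', one_mul, add_assoc,
      ← add_smul, add_sub_cancel]
  rw [heq]
  have h0 := hasDerivAt_det_one_add_smul_zero (B * A)
  rw [← sub_self s] at h0
  simpa using (HasDerivAt.comp_sub_const s s h0).const_mul (1 + s • A).det

/-- At t = 0 the determinant is 1, and by the intermediate value theorem it cannot change sign
without a zero. -/
theorem det_one_add_smul_pos {A : Matrix n n ℝ} {s : ℝ}
    (h : ∀ t : ℝ, |t| ≤ |s| → (1 + t • A).det ≠ 0) : 0 < (1 + s • A).det := by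
  by_contra hneg
  have hc : Continuous fun t : ℝ => (1 + t • A).det := by
    refine Continuous.matrix_det ?_
    fun_prop
  have hmem : ∀ t ∈ Icc (-|s|) |s|, (1 + t • A).det ≠ 0 := fun t ht => h t (abs_le.2 ht)
  obtain ⟨t, ht, h0⟩ := isPreconnected_Icc.intermediate_value (f := fun t : ℝ => (1 + t • A).det)
    (a := s) (b := 0) (abs_le.1 le_rfl) (abs_le.1 (by simp)) hc.continuousOn
    (show (0 : ℝ) ∈ Icc _ _ from ⟨not_lt.1 hneg, by simp⟩)
  exact hmem t ht h0

end Determinants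

/-! ### The displacement along ∇Φ: Jacobian, support and image -/

section GradientDisplacement

open Matrix

variable {d : ℕ} {Φ : Rd d → ℝ} {C : NNReal} {s : ℝ}

theorem contDiff_pd {u : Rd d → ℝ} (hu : ContDiff ℝ ∞ u) (i : Fin d) : ContDiff ℝ ∞ (pd i u) :=
  contDiffOn_univ.1 (ContDiffOn.dirDeriv isOpen_univ hu.contDiffOn _)

theorem contDiff_gradient (hΦ : ContDiff ℝ ∞ Φ) : ContDiff ℝ ∞ (gradient Φ) := by
  rw [contDiff_euclidean]
  intro i
  simp only [gradient_apply]
  exact contDiff_pd hΦ i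

theorem gradient_eq_zero_of_notMem_tsupport {x : Rd d} (hx : x ∉ tsupport Φ) :
    gradient Φ x = 0 := by
  rw [gradient, image_eq_zero_of_notMem_tsupport fun h => hx (tsupport_fderiv_subset ℝ h), map_zero]

theorem hessian_symm (hΦ : ContDiff ℝ ∞ Φ) (x : Rd d) (i j : Fin d) :
    hessian Φ x i j = hessian Φ x j i :=
  pd_comm isOpen_univ hΦ.contDiffOn i j (mem_univ x)

theorem fderiv_gradient_apply (hΦ : ContDiff ℝ ∞ Φ) (x v : Rd d) (i : Fin d) :
    fderiv ℝ (gradient Φ) x v i = ∑ j, hessian Φ x i j * v j := by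
  have h1 := ((contDiff_gradient hΦ).differentiable (by simp) x).hasFDerivAt
  have h2 := (EuclideanSpace.proj (𝕜 := ℝ) i).hasFDerivAt.comp x h1
  change HasFDerivAt (fun y => gradient Φ y i) _ x at h2
  simp only [gradient_apply] at h2
  have h3 : fderiv ℝ (pd i Φ) x v = fderiv ℝ (gradient Φ) x v i := by
    rw [h2.fderiv]
    rfl
  rw [← h3, fderiv_eq_sum_pd]
  refine Finset.sum_congr rfl fun j _ => ?_
  rw [hessian_symm hΦ, mul_comm]
  rfl

theorem add_smul_fderiv_gradient_eq (hΦ : ContDiff ℝ ∞ Φ) (s : ℝ) (x : Rd d) :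
    ((ContinuousLinearMap.id ℝ (Rd d) + s • fderiv ℝ (gradient Φ) x : Rd d →L[ℝ] Rd d) :
      Rd d →ₗ[ℝ] Rd d) = toEuclideanLin (1 + s • hessian Φ x) := by
  ext v i
  simp [toLpLin_apply, fderiv_gradient_apply hΦ, mulVec, dotProduct]

/-- The Jacobian determinant of the displacement along `∇Φ`. -/
noncomputable def displacementJacobian (Φ : Rd d → ℝ) (s : ℝ) (x : Rd d) : ℝ :=
  (1 + s • hessian Φ x).det

theorem det_fderiv_displacement (hΦ : ContDiff ℝ ∞ Φ) (s : ℝ) (x : Rd d) :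
    (ContinuousLinearMap.id ℝ (Rd d) + s • fderiv ℝ (gradient Φ) x).det
      = displacementJacobian Φ s x := by
  rw [ContinuousLinearMap.det, add_smul_fderiv_gradient_eq hΦ, toEuclideanLin_eq_toLin_orthonormal,
    LinearMap.det_toLin, displacementJacobian]

theorem displacementJacobian_ne_zero (hΦ : ContDiff ℝ ∞ Φ) (hC : LipschitzWith C (gradient Φ))
    (hs : |s| * C < 1) (x : Rd d) : displacementJacobian Φ s x ≠ 0 := by
  rw [← det_fderiv_displacement hΦ]
  intro h
  refine LinearMap.bot_lt_ker_of_det_eq_zero h |>.ne' (LinearMap.ker_eq_bot'.2 fun v hv => ?_)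
  exact eq_zero_of_add_smul_fderiv_eq_zero hC hs (x := x) (by simpa using hv)

theorem displacementJacobian_pos (hΦ : ContDiff ℝ ∞ Φ) (hC : LipschitzWith C (gradient Φ))
    (hs : |s| * C < 1) (x : Rd d) : 0 < displacementJacobian Φ s x :=
  det_one_add_smul_pos fun _ ht => displacementJacobian_ne_zero hΦ hC
    ((mul_le_mul_of_nonneg_right ht C.2).trans_lt hs) x

theorem contDiff_displacementJacobian (hΦ : ContDiff ℝ ∞ Φ) :
    ContDiff ℝ ∞ fun p : ℝ × Rd d => displacementJacobian Φ p.1 p.2 := by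
  simp only [displacementJacobian, det_apply]
  refine ContDiff.sum fun σ _ => ContDiff.const_smul _ (contDiff_prod fun i _ => ?_)
  simp only [Matrix.add_apply, Matrix.smul_apply, smul_eq_mul]
  exact contDiff_const.add
    (contDiff_fst.mul ((contDiff_pd (contDiff_pd hΦ i) (σ i)).comp contDiff_snd))

theorem displacement_of_notMem_tsupport {x : Rd d} (hx : x ∉ tsupport Φ) (s : ℝ) :
    displacement (gradient Φ) s x = x := by
  simp [displacement, gradient_eq_zero_of_notMem_tsupport hx]

theorem displacementInv_of_notMem_tsupport (hC : LipschitzWith C (gradient Φ)) (hs : |s| * C < 1)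
    {y : Rd d} (hy : y ∉ tsupport Φ) : displacementInv (gradient Φ) (s, y) = y := by
  conv_lhs => rw [← displacement_of_notMem_tsupport hy s]
  exact displacementInv_displacement hC hs y

/-- Points outside the support are fixed, so none of them can be carried into it. -/
theorem displacementInv_mem_tsupport (hC : LipschitzWith C (gradient Φ)) (hs : |s| * C < 1)
    {y : Rd d} (hy : y ∈ tsupport Φ) : displacementInv (gradient Φ) (s, y) ∈ tsupport Φ := by
  by_contra h
  have := displacement_of_notMem_tsupport h s
  rw [displacement_displacementInv hC hs] at this
  exact h (this ▸ hy)

theorem displacementInv_mem {Ω : Set (Rd d)} (hΩ : tsupport Φ ⊆ Ω)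
    (hC : LipschitzWith C (gradient Φ)) (hs : |s| * C < 1)
    {y : Rd d} (hy : y ∈ Ω) : displacementInv (gradient Φ) (s, y) ∈ Ω := by
  by_cases h : y ∈ tsupport Φ
  · exact hΩ (displacementInv_mem_tsupport hC hs h)
  · rwa [displacementInv_of_notMem_tsupport hC hs h]

theorem displacement_mem {Ω : Set (Rd d)} (hΩ : tsupport Φ ⊆ Ω)
    (hC : LipschitzWith C (gradient Φ)) (hs : |s| * C < 1)
    {x : Rd d} (hx : x ∈ Ω) : displacement (gradient Φ) s x ∈ Ω := by
  by_cases h : displacement (gradient Φ) s x ∈ tsupport Φ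
  · exact hΩ h
  · have := displacementInv_of_notMem_tsupport hC hs h
    rw [displacementInv_displacement hC hs] at this
    rwa [← this]

/-- This makes the change of variables take place within Ω, which is what conserves the mass there.
-/
theorem displacement_image {Ω : Set (Rd d)} (hΩ : tsupport Φ ⊆ Ω)
    (hC : LipschitzWith C (gradient Φ)) (hs : |s| * C < 1) :
    displacement (gradient Φ) s '' Ω = Ω := by
  refine Subset.antisymm ?_ fun y hy =>
    ⟨_, displacementInv_mem hΩ hC hs hy, displacement_displacementInv hC hs y⟩
  rintro _ ⟨x, hx, rfl⟩
  exact displacement_mem hΩ hC hs hx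

end GradientDisplacement

/-! ### Construction of geodesics by characteristics -/

section DisplacementGeodesic

open Matrix

variable {d : ℕ} {Ω : Set (Rd d)} {ρ Φ : Rd d → ℝ} {C : NNReal} {s : ℝ}

/-- The density transported by the displacement along `∇Φ`. -/
noncomputable def transportedDensity (ρ Φ : Rd d → ℝ) (s : ℝ) (y : Rd d) : ℝ :=
  ρ (displacementInv (gradient Φ) (s, y))
    / displacementJacobian Φ s (displacementInv (gradient Φ) (s, y))

/-- The solution of the Hamilton-Jacobi equation by characteristics, with initial value `Φ`. -/
noncomputable def characteristicPotential (Φ : Rd d → ℝ) (s : ℝ) (y : Rd d) : ℝ :=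
  Φ (displacementInv (gradient Φ) (s, y))
    + s * (1 / 2 * ‖gradient Φ (displacementInv (gradient Φ) (s, y))‖ ^ 2)

theorem transportedDensity_displacement (hC : LipschitzWith C (gradient Φ)) (hs : |s| * C < 1)
    (x : Rd d) : transportedDensity ρ Φ s (displacement (gradient Φ) s x)
      = ρ x / displacementJacobian Φ s x := by
  rw [transportedDensity, displacementInv_displacement hC hs]

theorem characteristicPotential_displacement (hC : LipschitzWith C (gradient Φ))
    (hs : |s| * C < 1) (x : Rd d) :
    characteristicPotential Φ s (displacement (gradient Φ) s x)
      = Φ x + s * (1 / 2 * ‖gradient Φ x‖ ^ 2) := by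
  rw [characteristicPotential, displacementInv_displacement hC hs]

theorem contDiffOn_transportedDensity (hρ : IsDensity Ω ρ) (hΦ : IsTest Ω Φ)
    (hC : LipschitzWith C (gradient Φ)) {J : Set ℝ} (hJ : ∀ s ∈ J, |s| * C < 1) :
    ContDiffOn ℝ ∞ (fun p : ℝ × Rd d => transportedDensity ρ Φ p.1 p.2) (J ×ˢ Ω) := by
  have hY : ContDiffOn ℝ ∞ (displacementInv (gradient Φ)) (J ×ˢ Ω) := fun p hp =>
    (contDiffAt_displacementInv (contDiff_gradient hΦ.1) hC (hJ p.1 hp.1) p.2).contDiffWithinAt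
  refine ContDiffOn.div ?_ ?_ ?_
  · exact hρ.smooth.comp hY fun p hp => displacementInv_mem hΦ.2.2 hC (hJ p.1 hp.1) hp.2
  · exact (contDiff_displacementJacobian hΦ.1).comp_contDiffOn (contDiffOn_fst.prodMk hY)
  · exact fun p hp => displacementJacobian_ne_zero hΦ.1 hC (hJ p.1 hp.1) _

theorem contDiffAt_characteristicPotential (hΦ : ContDiff ℝ ∞ Φ)
    (hC : LipschitzWith C (gradient Φ)) (hs : |s| * C < 1) (y : Rd d) :
    ContDiffAt ℝ ∞ (fun p : ℝ × Rd d => characteristicPotential Φ p.1 p.2) (s, y) := by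
  have hY := contDiffAt_displacementInv (contDiff_gradient hΦ) hC hs y
  exact (hΦ.contDiffAt.comp _ hY).add (contDiffAt_fst.mul
    (contDiffAt_const.mul (((contDiff_gradient hΦ).contDiffAt.comp _ hY).norm_sq ℝ)))

/-- The density transported by the displacement is a density. -/
theorem isDensity_transportedDensity (hΩ : IsOpen Ω) (hρ : IsDensity Ω ρ) (hΦ : IsTest Ω Φ)
    (hC : LipschitzWith C (gradient Φ)) (hs : |s| * C < 1) :
    IsDensity Ω (transportedDensity ρ Φ s) := by
  have hd : ∀ x ∈ Ω, HasFDerivWithinAt (displacement (gradient Φ) s) _ Ω x := fun x _ =>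
    (hasFDerivAt_displacement (contDiff_gradient hΦ.1) s x).hasFDerivWithinAt
  have hinj := (displacement_injective hC hs).injOn (s := Ω)
  have heq : ∀ x, |(ContinuousLinearMap.id ℝ (Rd d) + s • fderiv ℝ (gradient Φ) x).det|
      • transportedDensity ρ Φ s (displacement (gradient Φ) s x) = ρ x := by
    intro x
    have hp := displacementJacobian_pos hΦ.1 hC hs x
    rw [det_fderiv_displacement hΦ.1, transportedDensity_displacement hC hs, abs_of_pos hp,
      smul_eq_mul, mul_div_cancel₀ _ hp.ne']
  refine ⟨?_, fun y hy => ?_, ?_, ?_⟩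
  · exact (contDiffOn_transportedDensity hρ hΦ hC (J := {s}) fun t ht => by
      rwa [mem_singleton_iff.1 ht]).slice (mem_singleton s)
  · exact div_pos (hρ.pos _ (displacementInv_mem hΦ.2.2 hC hs hy))
      (displacementJacobian_pos hΦ.1 hC hs _)
  · rw [← displacement_image hΦ.2.2 hC hs, integrableOn_image_iff_integrableOn_abs_det_fderiv_smul
      volume hΩ.measurableSet hd hinj]
    simpa only [heq] using hρ.integrable
  · conv_lhs => rw [← displacement_image hΦ.2.2 hC hs]
    rw [integral_image_eq_integral_abs_det_fderiv_smul volume hΩ.measurableSet hd hinj]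
    simpa only [heq] using hρ.integral_eq_one

theorem differentiableAt_characteristicPotential (hΦ : ContDiff ℝ ∞ Φ)
    (hC : LipschitzWith C (gradient Φ)) (hs : |s| * C < 1) (y : Rd d) :
    DifferentiableAt ℝ (characteristicPotential Φ s) y :=
  ((contDiffAt_characteristicPotential hΦ hC hs y).comp y
    (contDiffAt_const.prodMk contDiffAt_id)).differentiableAt (by simp)

/-- Differentiating φ_s(X_s x) = Φ(x) + (s/2)‖∇Φ(x)‖² in a direction v gives ⟨∇Φ, (1 + sD∇Φ)v⟩, and
every w has the form (1 + sD∇Φ)v. -/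
theorem fderiv_characteristicPotential (hΦ : ContDiff ℝ ∞ Φ)
    (hC : LipschitzWith C (gradient Φ)) (hs : |s| * C < 1) (x w : Rd d) :
    fderiv ℝ (characteristicPotential Φ s) (displacement (gradient Φ) s x) w
      = inner ℝ (gradient Φ x) w := by
  obtain ⟨v, rfl⟩ := exists_add_smul_fderiv_eq hC hs x w
  have hV := (contDiff_gradient hΦ).differentiable (by simp) x
  have h1 : HasFDerivAt (fun z => characteristicPotential Φ s (displacement (gradient Φ) s z)) _ x :=
    HasFDerivAt.comp x (differentiableAt_characteristicPotential hΦ hC hs _).hasFDerivAt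
      (hasFDerivAt_displacement (contDiff_gradient hΦ) s x)
  simp only [characteristicPotential_displacement hC hs] at h1
  have h2 : HasFDerivAt (fun z => Φ z + s * (1 / 2 * ‖gradient Φ z‖ ^ 2)) _ x :=
    (hΦ.differentiable (by simp) x).hasFDerivAt.add
      ((hV.hasFDerivAt.norm_sq.const_mul (1 / 2)).const_mul s)
  have h3 := congrArg (fun L => L v) (h1.unique h2)
  simp only [ContinuousLinearMap.comp_apply, _root_.add_apply,
    _root_.smul_apply, ContinuousLinearMap.id_apply] at h3
  rw [h3, inner_add_right, inner_smul_right]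
  have h4 : fderiv ℝ Φ x v = inner ℝ (gradient Φ x) v := by
    rw [gradient, InnerProductSpace.toDual_symm_apply]
  rw [h4]
  simp

theorem gradient_characteristicPotential (hΦ : ContDiff ℝ ∞ Φ)
    (hC : LipschitzWith C (gradient Φ)) (hs : |s| * C < 1) (y : Rd d) :
    gradient (characteristicPotential Φ s) y
      = gradient Φ (displacementInv (gradient Φ) (s, y)) := by
  obtain ⟨x, rfl⟩ := displacement_surjective hC hs y
  rw [displacementInv_displacement hC hs]
  refine ext_inner_right ℝ fun w => ?_
  rw [← fderiv_characteristicPotential hΦ hC hs x w, gradient, InnerProductSpace.toDual_symm_apply]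

/-- The derivative in time along a characteristic. -/
theorem hasDerivAt_along_displacement {h : ℝ × Rd d → ℝ} (x : Rd d)
    (hh : DifferentiableAt ℝ h (s, displacement (gradient Φ) s x)) :
    HasDerivAt (fun t => h (t, displacement (gradient Φ) t x))
      (dirDeriv ((1 : ℝ), (0 : Rd d)) h (s, displacement (gradient Φ) s x)
        + fderiv ℝ (fun y => h (s, y)) (displacement (gradient Φ) s x) (gradient Φ x)) s := by
  have h1 : HasDerivAt (fun t : ℝ => (t, displacement (gradient Φ) t x)) (1, gradient Φ x) s := by
    refine (hasDerivAt_id s).prodMk ?_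
    exact (((hasDerivAt_id s).smul_const (gradient Φ x)).const_add x).congr_deriv (one_smul ℝ _)
  have h2 := hh.hasFDerivAt.comp_hasDerivAt s h1
  refine h2.congr_deriv ?_
  have h3 := dirDeriv_slice hh (gradient Φ x)
  simp only [dirDeriv] at h3 ⊢
  rw [h3, ← map_add]
  simp

/-- The Hamilton-Jacobi equation. -/
theorem hasDerivAt_characteristicPotential (hΦ : ContDiff ℝ ∞ Φ)
    (hC : LipschitzWith C (gradient Φ)) (hs : |s| * C < 1) (y : Rd d) :
    HasDerivAt (fun t => characteristicPotential Φ t y)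
      (-(1 / 2 * ‖gradient (characteristicPotential Φ s) y‖ ^ 2)) s := by
  obtain ⟨x, rfl⟩ := displacement_surjective hC hs y
  have hd := (contDiffAt_characteristicPotential hΦ hC hs
    (displacement (gradient Φ) s x)).differentiableAt (by simp)
  refine (hasDerivAt_slice hd).congr_deriv ?_
  rw [gradient_characteristicPotential hΦ hC hs, displacementInv_displacement hC hs]
  -- The total derivative along the characteristic is ∂_tφ + ‖∇Φ‖² by the chain rule and ½‖∇Φ‖² by
  -- the explicit formula.
  have h1 := hasDerivAt_along_displacement (Φ := Φ) x hd
  have h2 : HasDerivAt (fun t => Φ x + t * (1 / 2 * ‖gradient Φ x‖ ^ 2))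
      (1 / 2 * ‖gradient Φ x‖ ^ 2) s :=
    (hasDerivAt_mul_const _).const_add _
  have h3 := h1.unique (h2.congr_of_eventuallyEq (by
    have : ∀ᶠ t : ℝ in 𝓝 s, |t| * (C : ℝ) < 1 :=
      (isOpen_lt (by fun_prop) continuous_const).mem_nhds hs
    filter_upwards [this] with t ht using characteristicPotential_displacement hC ht x))
  have h4 := fderiv_characteristicPotential hΦ hC hs x (gradient Φ x)
  rw [real_inner_self_eq_norm_sq] at h4
  change _ + fderiv ℝ (characteristicPotential Φ s) _ _ = _ at h3
  rw [h4] at h3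
  linarith

/-- The Jacobian matrix of the inverse displacement. -/
noncomputable def jacobianInv (Φ : Rd d → ℝ) (s : ℝ) (y : Rd d) : Matrix (Fin d) (Fin d) ℝ :=
  Matrix.of fun k i =>
    fderiv ℝ (fun z => displacementInv (gradient Φ) (s, z)) y (EuclideanSpace.single i 1) k

theorem hasFDerivAt_displacementInv (hΦ : ContDiff ℝ ∞ Φ)
    (hC : LipschitzWith C (gradient Φ)) (hs : |s| * C < 1) (y : Rd d) :
    HasFDerivAt (fun z => displacementInv (gradient Φ) (s, z))
      (fderiv ℝ (fun z => displacementInv (gradient Φ) (s, z)) y) y :=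
  (((contDiffAt_displacementInv (contDiff_gradient hΦ) hC hs y).comp y
    (contDiffAt_const.prodMk contDiffAt_id)).differentiableAt (by simp)).hasFDerivAt

/-- The chain rule for X_s⁻¹ ∘ X_s = id, in matrix form. -/
theorem jacobianInv_mul (hΦ : ContDiff ℝ ∞ Φ)
    (hC : LipschitzWith C (gradient Φ)) (hs : |s| * C < 1) (x : Rd d) :
    jacobianInv Φ s (displacement (gradient Φ) s x) * (1 + s • hessian Φ x) = 1 := by
  have h1 : HasFDerivAt (fun z => displacementInv (gradient Φ) (s, displacement (gradient Φ) s z))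
      _ x := HasFDerivAt.comp x (hasFDerivAt_displacementInv hΦ hC hs _)
      (hasFDerivAt_displacement (contDiff_gradient hΦ) s x)
  simp only [displacementInv_displacement hC hs] at h1
  have h2 := h1.unique (hasFDerivAt_id x)
  ext k j
  have h3 := congrArg (fun L : Rd d →L[ℝ] Rd d => L (EuclideanSpace.single j 1) k) h2
  simp only [ContinuousLinearMap.comp_apply, ContinuousLinearMap.id_apply] at h3
  have h4 : (ContinuousLinearMap.id ℝ (Rd d) + s • fderiv ℝ (gradient Φ) x)
      (EuclideanSpace.single j 1)
      = ∑ i, (1 + s • hessian Φ x) i j • EuclideanSpace.single i (1 : ℝ) := by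
    change ((ContinuousLinearMap.id ℝ (Rd d) + s • fderiv ℝ (gradient Φ) x : Rd d →L[ℝ] Rd d) :
      Rd d →ₗ[ℝ] Rd d) _ = _
    rw [add_smul_fderiv_gradient_eq hΦ]
    ext i
    simp [toLpLin_apply, Finset.sum_apply, Pi.single_apply, one_apply]
  rw [h4, map_sum] at h3
  simp only [map_smul] at h3
  simpa [mul_apply, jacobianInv, mul_comm, one_apply, Pi.single_apply] using h3

/-- Because ∇φ_s = ∇Φ ∘ X_s⁻¹, the Laplacian of φ_s is exactly the trace in Jacobi's formula, i.e.
the logarithmic time derivative of the Jacobian. -/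
theorem sum_pd_pd_characteristicPotential (hΦ : ContDiff ℝ ∞ Φ)
    (hC : LipschitzWith C (gradient Φ)) (hs : |s| * C < 1) (x : Rd d) :
    ∑ i, pd i (pd i (characteristicPotential Φ s)) (displacement (gradient Φ) s x)
      = (jacobianInv Φ s (displacement (gradient Φ) s x) * hessian Φ x).trace := by
  have h1 : ∀ i, pd i (characteristicPotential Φ s)
      = fun y => pd i Φ (displacementInv (gradient Φ) (s, y)) := by
    intro i
    funext y
    rw [← gradient_apply, gradient_characteristicPotential hΦ hC hs, gradient_apply]
  rw [trace_mul_comm, trace]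
  refine Finset.sum_congr rfl fun i _ => ?_
  have h2 : HasFDerivAt (fun y => pd i Φ (displacementInv (gradient Φ) (s, y))) _
      (displacement (gradient Φ) s x) :=
    HasFDerivAt.comp (displacement (gradient Φ) s x)
      ((contDiff_pd hΦ i).differentiable (by simp) _).hasFDerivAt
      (hasFDerivAt_displacementInv hΦ hC hs (displacement (gradient Φ) s x))
  rw [h1 i, pd, h2.fderiv, ContinuousLinearMap.comp_apply, displacementInv_displacement hC hs,
    fderiv_eq_sum_pd, diag_apply, mul_apply]
  refine Finset.sum_congr rfl fun k _ => ?_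
  rw [hessian_symm hΦ, mul_comm]
  rfl

/-- The continuity equation. -/
theorem hasDerivAt_transportedDensity (hΩ : IsOpen Ω) (hρ : IsDensity Ω ρ) (hΦ : IsTest Ω Φ)
    (hC : LipschitzWith C (gradient Φ)) (hs : |s| * C < 1) {y : Rd d} (hy : y ∈ Ω) :
    HasDerivAt (fun t => transportedDensity ρ Φ t y)
      (metricInv (transportedDensity ρ Φ s) (characteristicPotential Φ s) y) s := by
  obtain ⟨x, rfl⟩ := displacement_surjective hC hs y
  set y := displacement (gradient Φ) s x
  set J : Set ℝ := {t | |t| * C < 1}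
  have hJ : IsOpen J := isOpen_lt (by fun_prop) continuous_const
  have hR := contDiffOn_transportedDensity hρ hΦ hC (J := J) fun t ht => ht
  have hd := hR.differentiableAt_of_isOpen (hJ.prod hΩ) (x := (s, y)) ⟨hs, hy⟩
  refine (hasDerivAt_slice hd).congr_deriv ?_
  have hne := displacementJacobian_ne_zero hΦ.1 hC hs x
  have h1 := hasDerivAt_along_displacement (Φ := Φ) x hd
  have h2 := hasDerivAt_det_one_add_smul (jacobianInv_mul hΦ.1 hC hs x)
  rw [← sum_pd_pd_characteristicPotential hΦ.1 hC hs x] at h2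
  -- The product of density and Jacobian equals ρ(x) along the trajectory, so its derivative is
  -- zero; dividing by the Jacobian leaves the continuity equation.
  have h3 := (h1.mul h2).unique ((hasDerivAt_const s (ρ x)).congr_of_eventuallyEq (by
    filter_upwards [hJ.mem_nhds hs] with t ht
    change transportedDensity ρ Φ t (displacement (gradient Φ) t x) * displacementJacobian Φ t x = _
    rw [transportedDensity_displacement hC ht,
      div_mul_cancel₀ _ (displacementJacobian_ne_zero hΦ.1 hC ht x)]))
  have hrs : SmoothOn Ω (transportedDensity ρ Φ s) := hR.slice hs
  have hφs : SmoothOn Ω (characteristicPotential Φ s) := fun z _ =>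
    ((contDiffAt_characteristicPotential hΦ.1 hC hs z).comp z
      (contDiffAt_const.prodMk contDiffAt_id)).contDiffWithinAt
  have h4 : ∀ i, pd i (fun z => transportedDensity ρ Φ s z * pd i (characteristicPotential Φ s) z) y
      = gradient Φ x i * pd i (transportedDensity ρ Φ s) y
        + transportedDensity ρ Φ s y * pd i (pd i (characteristicPotential Φ s)) y := by
    intro i
    change dirDeriv _ _ _ = _
    rw [dirDeriv_mul _ (hrs.diff hΩ hy) ((hφs.pd hΩ i).diff hΩ hy), ← gradient_apply,
      gradient_characteristicPotential hΦ.1 hC hs, displacementInv_displacement hC hs,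
      ← pd_eq_dirDeriv, mul_comm]
  rw [metricInv_eq, Finset.sum_congr rfl fun i _ => h4 i, Finset.sum_add_distrib, ← Finset.mul_sum]
  rw [fderiv_eq_sum_pd] at h3
  change (_ + ∑ i, gradient Φ x i * pd i (transportedDensity ρ Φ s) y)
    * displacementJacobian Φ s x + transportedDensity ρ Φ s y
      * (displacementJacobian Φ s x * _) = 0 at h3
  refine mul_right_cancel₀ hne ?_
  linear_combination h3

/-- Wasserstein geodesics with a compactly supported initial potential exist for a short time. -/
theorem exists_isWassersteinGeodesic (hΩ : IsOpen Ω) (hρ : IsDensity Ω ρ) (hΦ : IsTest Ω Φ) :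
    ∃ r φ, IsWassersteinGeodesic Ω ρ Φ r φ := by
  have hcs : HasCompactSupport (gradient Φ) :=
    HasCompactSupport.intro hΦ.2.1.isCompact fun x hx => gradient_eq_zero_of_notMem_tsupport hx
  obtain ⟨C, hC⟩ :=
    ContDiff.lipschitzWith_of_hasCompactSupport hcs (contDiff_gradient hΦ.1) (by simp)
  -- C + 1 instead of C covers the case C = 0.
  have hε : (0 : ℝ) < 1 / (C + 1) := by positivity
  have hJ : ∀ s ∈ Ioo (-(1 / ((C : ℝ) + 1))) (1 / (C + 1)), |s| * C < 1 := by
    intro s hs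
    have h1 : |s| < 1 / ((C : ℝ) + 1) := abs_lt.2 hs
    rw [lt_div_iff₀ (by positivity)] at h1
    nlinarith [abs_nonneg s]
  have h0 : |(0 : ℝ)| * C < 1 := by simp
  have hinv0 : ∀ x, displacementInv (gradient Φ) (0, x) = x := fun x => by
    simpa [displacement] using displacementInv_displacement hC h0 x
  refine ⟨transportedDensity ρ Φ, characteristicPotential Φ, _, hε, tsupport Φ, hΦ.2.2,
    hΦ.2.1.isCompact, contDiffOn_transportedDensity hρ hΦ hC hJ, fun p hp =>
      (contDiffAt_characteristicPotential hΦ.1 hC (hJ p.1 hp.1) p.2).contDiffWithinAt,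
    fun x _ => ?_, fun s hs => ⟨isDensity_transportedDensity hΩ hρ hΦ hC (hJ s hs),
      fun x hx => ?_, fun x hx => ⟨hasDerivAt_transportedDensity hΩ hρ hΦ hC (hJ s hs) hx,
        hasDerivAt_characteristicPotential hΦ.1 hC (hJ s hs) x⟩⟩⟩
  · simp [transportedDensity, characteristicPotential, hinv0, displacementJacobian]
  · rw [characteristicPotential, displacementInv_of_notMem_tsupport hC (hJ s hs) hx.2,
      gradient_eq_zero_of_notMem_tsupport hx.2, image_eq_zero_of_notMem_tsupport hx.2]
    simp

end DisplacementGeodesic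

/-! ### The Hessian operator: existence and uniqueness -/

section HessianOperator

variable {d : ℕ} {Ω K : Set (Rd d)} {f ρ : Rd d → ℝ}

/-- The integrand of the Hessian bilinear form of the relative entropy. -/
noncomputable def hessianFormDensity (f ρ Φ Ψ : Rd d → ℝ) (x : Rd d) : ℝ :=
  ρ x * (∑ i, ∑ j, pd i (pd j Ψ) x * pd j (pd i Φ) x
    + ∑ i, ∑ j, pd i Ψ x * (pd i (pd j f) x * pd j Φ x))

theorem hessianFormDensity_comm (hΩ : IsOpen Ω) (hf : SmoothOn Ω f) (Φ Ψ : Rd d → ℝ) :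
    ∀ x ∈ Ω, hessianFormDensity f ρ Φ Ψ x = hessianFormDensity f ρ Ψ Φ x := by
  intro x hx
  have h1 : ∑ i, ∑ j, pd i (pd j Ψ) x * pd j (pd i Φ) x
      = ∑ i, ∑ j, pd i (pd j Φ) x * pd j (pd i Ψ) x := by
    rw [Finset.sum_comm]
    exact Finset.sum_congr rfl fun i _ => Finset.sum_congr rfl fun j _ => mul_comm _ _
  have h2 : ∑ i, ∑ j, pd i Ψ x * (pd i (pd j f) x * pd j Φ x)
      = ∑ i, ∑ j, pd i Φ x * (pd i (pd j f) x * pd j Ψ x) := by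
    rw [Finset.sum_comm]
    refine Finset.sum_congr rfl fun i _ => Finset.sum_congr rfl fun j _ => ?_
    rw [pd_comm hΩ hf i j hx]
    ring
  rw [hessianFormDensity, hessianFormDensity, h1, h2]

theorem hessianFormDensity_self (hΩ : IsOpen Ω) {Φ : Rd d → ℝ} (hΦ : SmoothOn Ω Φ) :
    ∀ x ∈ Ω, hessianFormDensity f ρ Φ Φ x = ((∑ i, ∑ j, hessian Φ x i j ^ 2)
      + inner ℝ (gradient Φ x) (hessianMulGradient f Φ x)) * ρ x := by
  intro x hx
  rw [hessianFormDensity, inner_gradient_hessianMulGradient, mul_comm]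
  congr 2
  refine Finset.sum_congr rfl fun i _ => Finset.sum_congr rfl fun j _ => ?_
  rw [pd_comm hΩ hΦ j i hx, pow_two]
  rfl

theorem klHessian_eq (f ρ Φ : Rd d → ℝ) (x : Rd d) :
    klHessian f ρ Φ x = ∑ i, ∑ j, pd i (pd j (fun y => ρ y * pd i (pd j Φ) y)) x
      - ∑ i, pd i (fun y => ρ y * ∑ j, pd i (pd j f) y * pd j Φ y) x := by
  rw [klHessian, doubleDivergence_smul_hessian, divergence_smul_hessianMulGradient]

theorem smoothOn_mul_hessian_mul_gradient (hΩ : IsOpen Ω) (hf : SmoothOn Ω f)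
    (hρ : SmoothOn Ω ρ) {Φ : Rd d → ℝ} (hΦ : SmoothOn Ω Φ) (i : Fin d) :
    SmoothOn Ω fun y => ρ y * ∑ j, pd i (pd j f) y * pd j Φ y :=
  hρ.mul (SmoothOn.sum fun j _ => ((hf.pd hΩ j).pd hΩ i).mul (hΦ.pd hΩ j))

theorem smoothOn_mul_hessian (hΩ : IsOpen Ω) (hρ : SmoothOn Ω ρ) {Φ : Rd d → ℝ}
    (hΦ : SmoothOn Ω Φ) (i j : Fin d) : SmoothOn Ω fun y => ρ y * pd i (pd j Φ) y :=
  hρ.mul ((hΦ.pd hΩ j).pd hΩ i)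

theorem SmoothOn.klHessian (hΩ : IsOpen Ω) (hf : SmoothOn Ω f) (hρ : SmoothOn Ω ρ)
    {Φ : Rd d → ℝ} (hΦ : SmoothOn Ω Φ) : SmoothOn Ω (klHessian f ρ Φ) := by
  rw [show _root_.klHessian f ρ Φ = _ from funext (klHessian_eq f ρ Φ)]
  exact (SmoothOn.sum fun i _ => SmoothOn.sum fun j _ =>
    ((smoothOn_mul_hessian hΩ hρ hΦ i j).pd hΩ j).pd hΩ i).sub
    (SmoothOn.sum fun i _ => (smoothOn_mul_hessian_mul_gradient hΩ hf hρ hΦ i).pd hΩ i)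

theorem VanishesOff.klHessian (hΩ : IsOpen Ω) (hK : IsCompact K) (f ρ : Rd d → ℝ)
    {Φ : Rd d → ℝ} (hΦ : VanishesOff Ω K Φ) : VanishesOff Ω K (klHessian f ρ Φ) := by
  rw [show _root_.klHessian f ρ Φ = _ from funext (klHessian_eq f ρ Φ)]
  exact (VanishesOff.sum fun i _ => VanishesOff.sum fun j _ =>
    ((((hΦ.pd hΩ hK j).pd hΩ hK i).mul_left ρ).pd hΩ hK j).pd hΩ hK i).sub
    (VanishesOff.sum fun i _ => ((VanishesOff.sum fun j _ =>
      (hΦ.pd hΩ hK j).mul_left _).mul_left ρ).pd hΩ hK i)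

theorem klHessian_linear (hΩ : IsOpen Ω) (hf : SmoothOn Ω f) (hρ : SmoothOn Ω ρ)
    (a b : ℝ) {Φ Ψ : Rd d → ℝ} (hΦ : SmoothOn Ω Φ) (hΨ : SmoothOn Ω Ψ) :
    ∀ x ∈ Ω, klHessian f ρ (fun y => a * Φ y + b * Ψ y) x
      = a * klHessian f ρ Φ x + b * klHessian f ρ Ψ x := by
  have hlin : ∀ {u w : Rd d → ℝ}, SmoothOn Ω u → SmoothOn Ω w → ∀ i, ∀ x ∈ Ω,
      pd i (fun y => a * u y + b * w y) x = a * pd i u x + b * pd i w x := by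
    intro u w hu hw i x hx
    change dirDeriv _ _ _ = _
    rw [dirDeriv_add _ ((hu.diff hΩ hx).const_mul a) ((hw.diff hΩ hx).const_mul b),
      dirDeriv_const_mul _ _ (hu.diff hΩ hx), dirDeriv_const_mul _ _ (hw.diff hΩ hx)]
    rfl
  have hlin2 : ∀ {u w : Rd d → ℝ}, SmoothOn Ω u → SmoothOn Ω w → ∀ i j, ∀ x ∈ Ω,
      pd i (pd j (fun y => a * u y + b * w y)) x
        = a * pd i (pd j u) x + b * pd i (pd j w) x := by
    intro u w hu hw i j x hx
    rw [pd_congr hΩ (hlin hu hw j) i x hx, hlin (hu.pd hΩ j) (hw.pd hΩ j) i x hx]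
  intro x hx
  have h1 : ∀ i j, pd i (pd j (fun y => ρ y * pd i (pd j (fun y => a * Φ y + b * Ψ y)) y)) x
      = a * pd i (pd j (fun y => ρ y * pd i (pd j Φ) y)) x
        + b * pd i (pd j (fun y => ρ y * pd i (pd j Ψ) y)) x := by
    intro i j
    rw [← hlin2 (smoothOn_mul_hessian hΩ hρ hΦ i j) (smoothOn_mul_hessian hΩ hρ hΨ i j) i j x hx]
    refine pd_congr hΩ (pd_congr hΩ (fun y hy => ?_) j) i x hx
    rw [hlin2 hΦ hΨ i j y hy]
    ring
  have h2 : ∀ i, pd i (fun y => ρ y * ∑ j, pd i (pd j f) y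
      * pd j (fun y => a * Φ y + b * Ψ y) y) x
      = a * pd i (fun y => ρ y * ∑ j, pd i (pd j f) y * pd j Φ y) x
        + b * pd i (fun y => ρ y * ∑ j, pd i (pd j f) y * pd j Ψ y) x := by
    intro i
    rw [← hlin (smoothOn_mul_hessian_mul_gradient hΩ hf hρ hΦ i)
      (smoothOn_mul_hessian_mul_gradient hΩ hf hρ hΨ i) i x hx]
    refine pd_congr hΩ (fun y hy => ?_) i x hx
    simp only [Finset.mul_sum, ← Finset.sum_add_distrib]
    refine Finset.sum_congr rfl fun j _ => ?_
    rw [hlin hΦ hΨ j y hy]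
    ring
  simp only [klHessian_eq, h1, h2, Finset.sum_add_distrib, ← Finset.mul_sum]
  ring

/-- Integration by parts for the Hessian operator of the relative entropy. -/
theorem integral_mul_klHessian (hΩ : IsOpen Ω) (hK : IsCompact K) (hKΩ : K ⊆ Ω)
    (hf : SmoothOn Ω f) (hρ : SmoothOn Ω ρ) {Φ Ψ : Rd d → ℝ} (hΦ : SmoothOn Ω Φ)
    (hΨ : SmoothOn Ω Ψ) (hv : VanishesOff Ω K Φ ∨ VanishesOff Ω K Ψ) :
    ∫ x in Ω, Ψ x * klHessian f ρ Φ x = ∫ x in Ω, hessianFormDensity f ρ Φ Ψ x := by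
  have hA := fun i j => smoothOn_mul_hessian hΩ hρ hΦ i j
  have hb := fun i => smoothOn_mul_hessian_mul_gradient hΩ hf hρ hΦ i
  have hS : ∀ i, SmoothOn Ω fun x => ∑ j, pd j (fun y => ρ y * pd i (pd j Φ) y) x :=
    fun i => SmoothOn.sum fun j _ => (hA i j).pd hΩ j
  have hT : ∀ i, SmoothOn Ω fun x => ∑ j, pd j Ψ x * (ρ x * pd j (pd i Φ) x) :=
    fun i => SmoothOn.sum fun j _ => (hΨ.pd hΩ j).mul (hA j i)
  refine setIntegral_eq_of_eq_add_divergence hΩ hK hKΩ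
    -- The flux combines both integrations by parts: the first part moves the outer derivative onto
    -- Ψ, the last sum moves the second one. The indices in the last sum are transposed so that the
    -- mixed terms cancel by relabelling alone.
    (v := fun i x => Ψ x * (∑ j, pd j (fun y => ρ y * pd i (pd j Φ) y) x
        - ρ x * ∑ j, pd i (pd j f) x * pd j Φ x)
      - ∑ j, pd j Ψ x * (ρ x * pd j (pd i Φ) x)) ?_ ?_ ?_ ?_ fun x hx => ?_
  · refine ContDiffOn.continuousOn (hρ.mul (SmoothOn.add ?_ ?_))
    · exact SmoothOn.sum fun i _ => SmoothOn.sum fun j _ =>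
        ((hΨ.pd hΩ j).pd hΩ i).mul ((hΦ.pd hΩ i).pd hΩ j)
    · exact SmoothOn.sum fun i _ => SmoothOn.sum fun j _ =>
        (hΨ.pd hΩ i).mul (((hf.pd hΩ j).pd hΩ i).mul (hΦ.pd hΩ j))
  · refine VanishesOff.mul_left (VanishesOff.add
      (VanishesOff.sum fun i _ => VanishesOff.sum fun j _ => ?_)
      (VanishesOff.sum fun i _ => VanishesOff.sum fun j _ => ?_)) ρ
    · rcases hv with hv | hv
      · exact ((hv.pd hΩ hK i).pd hΩ hK j).mul_left _
      · exact ((hv.pd hΩ hK j).pd hΩ hK i).mul_right _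
    · rcases hv with hv | hv
      · exact ((hv.pd hΩ hK j).mul_left _).mul_left _
      · exact (hv.pd hΩ hK i).mul_right _
  · exact fun i => (hΨ.mul ((hS i).sub (hb i))).sub (hT i)
  · intro i
    rcases hv with hv | hv
    · exact (((VanishesOff.sum fun j _ => (((hv.pd hΩ hK j).pd hΩ hK i).mul_left ρ).pd hΩ hK j).sub
        ((VanishesOff.sum fun j _ => (hv.pd hΩ hK j).mul_left _).mul_left ρ)).mul_left Ψ).sub
        (VanishesOff.sum fun j _ => (((hv.pd hΩ hK i).pd hΩ hK j).mul_left ρ).mul_left _)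
    · exact (hv.mul_right _).sub (VanishesOff.sum fun j _ => (hv.pd hΩ hK j).mul_right _)
  · have h1 : ∀ i, pd i (fun x => Ψ x * (∑ j, pd j (fun y => ρ y * pd i (pd j Φ) y) x
          - ρ x * ∑ j, pd i (pd j f) x * pd j Φ x)
          - ∑ j, pd j Ψ x * (ρ x * pd j (pd i Φ) x)) x
        = (pd i Ψ x * (∑ j, pd j (fun y => ρ y * pd i (pd j Φ) y) x
            - ρ x * ∑ j, pd i (pd j f) x * pd j Φ x)
          + Ψ x * (∑ j, pd i (pd j (fun y => ρ y * pd i (pd j Φ) y)) x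
            - pd i (fun x => ρ x * ∑ j, pd i (pd j f) x * pd j Φ x) x))
          - ∑ j, (pd i (pd j Ψ) x * (ρ x * pd j (pd i Φ) x)
            + pd j Ψ x * pd i (fun x => ρ x * pd j (pd i Φ) x) x) := by
      intro i
      change dirDeriv _ _ _ = _
      rw [dirDeriv_sub _ ((hΨ.mul ((hS i).sub (hb i))).diff hΩ hx) ((hT i).diff hΩ hx),
        dirDeriv_mul _ (hΨ.diff hΩ hx) (((hS i).sub (hb i)).diff hΩ hx),
        dirDeriv_sub _ ((hS i).diff hΩ hx) ((hb i).diff hΩ hx),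
        dirDeriv_sum _ _ fun j _ => ((hA i j).pd hΩ j).diff hΩ hx,
        dirDeriv_sum _ _ fun j _ => ((hΨ.pd hΩ j).mul (hA j i)).diff hΩ hx]
      congr 1
      refine Finset.sum_congr rfl fun j _ => ?_
      rw [dirDeriv_mul _ ((hΨ.pd hΩ j).diff hΩ hx) ((hA j i).diff hΩ hx)]
      rfl
    have h2 : ∑ i, ∑ j, pd j Ψ x * pd i (fun x => ρ x * pd j (pd i Φ) x) x
        = ∑ i, ∑ j, pd i Ψ x * pd j (fun y => ρ y * pd i (pd j Φ) y) x := Finset.sum_comm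
    have h3 : ∑ i, ∑ j, pd i (pd j Ψ) x * (ρ x * pd j (pd i Φ) x)
        = ρ x * ∑ i, ∑ j, pd i (pd j Ψ) x * pd j (pd i Φ) x := by
      simp only [Finset.mul_sum]
      exact Finset.sum_congr rfl fun i _ => Finset.sum_congr rfl fun j _ => by ring
    have h4 : ∑ i, pd i Ψ x * (ρ x * ∑ j, pd i (pd j f) x * pd j Φ x)
        = ρ x * ∑ i, ∑ j, pd i Ψ x * (pd i (pd j f) x * pd j Φ x) := by
      simp only [Finset.mul_sum]
      exact Finset.sum_congr rfl fun i _ => Finset.sum_congr rfl fun j _ => by ring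
    simp only [h1]
    simp only [Finset.sum_add_distrib, Finset.sum_sub_distrib, mul_sub]
    rw [h2, h3, h4, klHessian_eq, hessianFormDensity]
    simp only [Finset.mul_sum, mul_sub, mul_add]
    ring

/-- The second derivative of the relative entropy along geodesics. -/
theorem hasHessianForm_KL (hΩ : IsOpen Ω) (hf : SmoothOn Ω f)
    (hZ : IntegrableOn (fun x => Real.exp (-f x)) Ω) (hρ : IsDensity Ω ρ)
    (hfin : FiniteKL Ω f ρ) {Φ : Rd d → ℝ} (hΦ : IsTest Ω Φ) :
    HasHessianForm Ω (KL Ω f) ρ Φ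
      (∫ x in Ω, ((∑ i, ∑ j, hessian Φ x i j ^ 2)
        + inner ℝ (gradient Φ x) (hessianMulGradient f Φ x)) * ρ x) :=
  ⟨exists_isWassersteinGeodesic hΩ hρ hΦ, fun _ _ h =>
    h.hasSecondDerivAt_KL hΩ hf hZ hρ hfin hΦ.smoothOn⟩

/-- Both pairings integrate to the same symmetric density `hessianFormDensity`, whose diagonal is
the second derivative along geodesics. -/
theorem isHessianOperator_klHessian (hΩ : IsOpen Ω) (hf : SmoothOn Ω f)
    (hZ : IntegrableOn (fun x => Real.exp (-f x)) Ω) (hρ : IsDensity Ω ρ)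
    (hfin : FiniteKL Ω f ρ) : IsHessianOperator Ω (KL Ω f) ρ (klHessian f ρ) := by
  have hs : ∀ Φ, SmoothOn Ω Φ → SmoothOn Ω (klHessian f ρ Φ) :=
    fun _ hΦ => SmoothOn.klHessian hΩ hf hρ.smooth hΦ
  refine ⟨hs, fun a b _ _ hΦ hΨ => klHessian_linear hΩ hf hρ.smooth a b hΦ hΨ,
    fun Φ Ψ hΦ hΨ => ?_, fun Φ Ψ hΦ hΨ => ?_, fun Φ hΦ => ?_⟩
  · exact VanishesOff.integrableOn hΩ hΨ.2.1.isCompact hΨ.2.2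
      ((hΨ.vanishesOff.klHessian hΩ hΨ.2.1.isCompact f ρ).mul_left Φ)
      (hΦ.mul (hs Ψ hΨ.smoothOn)).continuousOn
  · rw [integral_mul_klHessian hΩ hΨ.2.1.isCompact hΨ.2.2 hf hρ.smooth hΦ hΨ.smoothOn
      (Or.inr hΨ.vanishesOff), integral_mul_klHessian hΩ hΨ.2.1.isCompact hΨ.2.2 hf hρ.smooth
      hΨ.smoothOn hΦ (Or.inl hΨ.vanishesOff)]
    exact setIntegral_congr_fun hΩ.measurableSet (hessianFormDensity_comm hΩ hf Φ Ψ)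
  · have heq : ∫ x in Ω, Φ x * klHessian f ρ Φ x
        = ∫ x in Ω, ((∑ i, ∑ j, hessian Φ x i j ^ 2)
          + inner ℝ (gradient Φ x) (hessianMulGradient f Φ x)) * ρ x := by
      rw [integral_mul_klHessian hΩ hΦ.2.1.isCompact hΦ.2.2 hf hρ.smooth hΦ.smoothOn hΦ.smoothOn
        (Or.inl hΦ.vanishesOff)]
      exact setIntegral_congr_fun hΩ.measurableSet (hessianFormDensity_self hΩ hΦ.smoothOn)
    rw [heq]
    exact hasHessianForm_KL hΩ hf hZ hρ hfin hΦ

/-- The existence of a geodesic is essential: without one the condition on q would be vacuous. -/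
theorem HasHessianForm.unique {E : (Rd d → ℝ) → ℝ} {Φ : Rd d → ℝ} {q q' : ℝ}
    (h : HasHessianForm Ω E ρ Φ q) (h' : HasHessianForm Ω E ρ Φ q') : q = q' := by
  obtain ⟨r, φ, hg⟩ := h.1
  exact (h.2 r φ hg).2.unique (h'.2 r φ hg).2

namespace IsHessianOperator

variable {E : (Rd d → ℝ) → ℝ} {H H' : (Rd d → ℝ) → (Rd d → ℝ)}

theorem integrable_test_mul (hΩ : IsOpen Ω) (h : IsHessianOperator Ω E ρ H) {Φ Ψ : Rd d → ℝ}
    (hΦ : SmoothOn Ω Φ) (hΨ : IsTest Ω Ψ) : IntegrableOn (fun x => Ψ x * H Φ x) Ω :=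
  (hΨ.vanishesOff.mul_right _).integrableOn hΩ hΨ.2.1.isCompact hΨ.2.2
    (hΨ.smoothOn.mul (h.smooth Φ hΦ)).continuousOn

/-- The polarization identity for the Hessian bilinear form. -/
theorem integral_add_mul (hΩ : IsOpen Ω) (h : IsHessianOperator Ω E ρ H) {Φ Ψ : Rd d → ℝ}
    (hΦ : IsTest Ω Φ) (hΨ : IsTest Ω Ψ) :
    ∫ x in Ω, (1 * Φ x + 1 * Ψ x) * H (fun y => 1 * Φ y + 1 * Ψ y) x
      = (∫ x in Ω, Φ x * H Φ x) + (∫ x in Ω, Ψ x * H Ψ x) + 2 * ∫ x in Ω, Ψ x * H Φ x := by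
  have h1 := h.integrable_test_mul hΩ hΦ.smoothOn hΦ
  have h2 := h.integrable_test_mul hΩ hΨ.smoothOn hΨ
  have h3 := h.integrable_test_mul hΩ hΦ.smoothOn hΨ
  have h4 := h.integrable_test_mul hΩ hΨ.smoothOn hΦ
  have h12 : IntegrableOn (fun x => Φ x * H Φ x + Ψ x * H Ψ x) Ω := h1.add h2
  have h34 : IntegrableOn (fun x => Ψ x * H Φ x + Φ x * H Ψ x) Ω := h3.add h4
  have h5 : ∀ x ∈ Ω, (1 * Φ x + 1 * Ψ x) * H (fun y => 1 * Φ y + 1 * Ψ y) x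
      = (Φ x * H Φ x + Ψ x * H Ψ x) + (Ψ x * H Φ x + Φ x * H Ψ x) := by
    intro x hx
    rw [h.linear 1 1 Φ Ψ hΦ.smoothOn hΨ.smoothOn x hx]
    ring
  rw [setIntegral_congr_fun hΩ.measurableSet h5, integral_add h12 h34,
    integral_add h1 h2, integral_add h3 h4, ← h.selfAdjoint Φ Ψ hΦ.smoothOn hΨ]
  ring

theorem eqOn_of_integral_eq (hΩ : IsOpen Ω) (h : IsHessianOperator Ω E ρ H)
    (h' : IsHessianOperator Ω E ρ H') {Φ : Rd d → ℝ} (hΦ : SmoothOn Ω Φ)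
    (heq : ∀ Ψ, IsTest Ω Ψ → ∫ x in Ω, Ψ x * H Φ x = ∫ x in Ω, Ψ x * H' Φ x) :
    ∀ x ∈ Ω, H Φ x = H' Φ x := by
  intro x hx
  refine sub_eq_zero.1 (eq_zero_of_forall_integral_test_mul_eq_zero hΩ
    (u := fun x => H Φ x - H' Φ x) ((h.smooth Φ hΦ).sub (h'.smooth Φ hΦ)).continuousOn
    (fun Ψ hΨ => ?_) x hx)
  simp only [mul_sub]
  rw [integral_sub (h.integrable_test_mul hΩ hΦ hΨ) (h'.integrable_test_mul hΩ hΦ hΨ), heq Ψ hΨ,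
    sub_self]

/-- The Hessian operator is unique. -/
theorem unique (hΩ : IsOpen Ω) (h : IsHessianOperator Ω E ρ H)
    (h' : IsHessianOperator Ω E ρ H') {Φ : Rd d → ℝ} (hΦ : SmoothOn Ω Φ) :
    ∀ x ∈ Ω, H Φ x = H' Φ x := by
  have hdiag : ∀ Φ, IsTest Ω Φ → ∫ x in Ω, Φ x * H Φ x = ∫ x in Ω, Φ x * H' Φ x :=
    fun Φ hΦ => (h.form Φ hΦ).unique (h'.form Φ hΦ)
  -- Polarization upgrades equality on the diagonal to equality of all pairings of test functions.
  have htest : ∀ Φ, IsTest Ω Φ → ∀ x ∈ Ω, H Φ x = H' Φ x := by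
    refine fun Φ hΦ => h.eqOn_of_integral_eq hΩ h' hΦ.smoothOn fun Ψ hΨ => ?_
    have h1 := hdiag _ (hΦ.linearCombination hΨ 1 1)
    rw [h.integral_add_mul hΩ hΦ hΨ, h'.integral_add_mul hΩ hΦ hΨ, hdiag Φ hΦ, hdiag Ψ hΨ] at h1
    linarith
  -- For general smooth Φ, self-adjointness puts the operator on the test function, where H and H'
  -- already agree.
  refine h.eqOn_of_integral_eq hΩ h' hΦ fun Ψ hΨ => ?_
  rw [h.selfAdjoint Φ Ψ hΦ hΨ, h'.selfAdjoint Φ Ψ hΦ hΨ]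
  exact setIntegral_congr_fun hΩ.measurableSet fun x hx => by simp only [htest Ψ hΨ x hx]

end IsHessianOperator

end HessianOperator

/-! ### The theorem -/

theorem theorem1 (d : ℕ) (Ω : Set (Rd d)) (hΩ : IsOpen Ω)
    (f : Rd d → ℝ) (hf : SmoothOn Ω f) (hZ : IntegrableOn (fun x => Real.exp (-f x)) Ω) :
    -- the Wasserstein Hessian of the KL divergence: its quadratic form and its operator
    (∀ ρ : Rd d → ℝ, IsDensity Ω ρ → FiniteKL Ω f ρ →
      (∀ Φ : Rd d → ℝ, IsTest Ω Φ →
        HasHessianForm Ω (KL Ω f) ρ Φ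
          (∫ x in Ω, ((∑ i, ∑ j, hessian Φ x i j ^ 2)
            + inner ℝ (gradient Φ x) (hessianMulGradient f Φ x)) * ρ x)) ∧
      IsHessianOperator Ω (KL Ω f) ρ (klHessian f ρ) ∧
      (∀ H : (Rd d → ℝ) → (Rd d → ℝ), IsHessianOperator Ω (KL Ω f) ρ H →
        ∀ Φ : Rd d → ℝ, SmoothOn Ω Φ → ∀ x ∈ Ω, H Φ x = klHessian f ρ Φ x)) ∧
    -- the Wasserstein Newton's flow of the KL divergence
    (∀ (I : Set ℝ) (ρ Φ : ℝ → Rd d → ℝ),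
      (∀ t ∈ I, IsDensity Ω (ρ t) ∧ FiniteKL Ω f (ρ t) ∧ SmoothOn Ω (Φ t)) →
      (IsWassersteinNewtonFlow Ω (KL Ω f) I ρ Φ ↔
        ∀ t ∈ I, ∀ x ∈ Ω,
          HasDerivWithinAt (fun s => ρ s x)
            (-divergence (fun y => ρ t y • gradient (Φ t) y) x) I t ∧
          doubleDivergence (fun y => ρ t y • hessian (Φ t) y) x
            - divergence (fun y => ρ t y • hessianMulGradient f (Φ t) y) x
            - divergence (fun y => ρ t y • gradient f y) x
            - Laplacian.laplacian (ρ t) x = 0)) := by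
  refine ⟨fun ρ hρ hfin => ⟨fun Φ hΦ => hasHessianForm_KL hΩ hf hZ hρ hfin hΦ,
    isHessianOperator_klHessian hΩ hf hZ hρ hfin, fun H hH Φ hΦ =>
      hH.unique hΩ (isHessianOperator_klHessian hΩ hf hZ hρ hfin) hΦ⟩, fun I ρ Φ hρΦ => ?_⟩
  refine forall₂_congr fun t ht => ?_
  obtain ⟨hρ, hfin, hΦ⟩ := hρΦ t ht
  have hH := isHessianOperator_klHessian hΩ hf hZ hρ hfin
  have hgrad := fun τ => isWassersteinGradient_KL_iff hΩ hf hZ hρ hfin (τ := τ)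
  rw [forall₂_and]
  refine and_congr Iff.rfl ⟨fun ⟨H, τ, hH', hτ, h⟩ x hx => ?_, fun h =>
    ⟨klHessian f (ρ t), _, hH, (hgrad _).2 fun x _ => rfl, fun x hx => ?_⟩⟩
  · have h1 := h x hx
    -- The flow provides some Hessian operator and some gradient; uniqueness replaces both by the
    -- explicit formulas.
    rw [hH'.unique hΩ hH hΦ x hx, (hgrad τ).1 hτ x hx, klHessian] at h1
    linarith
  · have h1 := h x hx
    rw [klHessian]
    linarith
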